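/- Let $\mathfrak g$ be a finite dimensional simple Lie algebra over $\mathbb C$, with basis $e_i$ and dual basis $\varepsilon_i$ of $\mathfrak g^*$. Let $B\otimes B$ be the quotient of the exterior algebra $\wedge(\mathfrak g^*\oplus\mathfrak g^*)$, with odd generators $x_i,y_i$ (the copies of $\varepsilon_i$ in the two summands), by the two-sided ideal generated by the coordinates of $\{X,X\}$ and of $\{Y,Y\}$; here $X=\sum_i x_i\otimes e_i$, $Y=\sum_i y_i\otimes e_i$, and $\{U,W\}=\sum_{i,j}u_iw_j\otimes[e_i,e_j]$ for $U=\sum_i u_i\otimes e_i$, $W=\sum_j w_j\otimes e_j$. (So $B=\wedge\mathfrak g^*/(\{X,X\}=0)$, and the tensor product is that of superalgebras.) Let $E=(B\otimes B)^{\mathfrak g}$ be the space of invariants of the coadjoint action. For $F\in S(\mathfrak g^*)$, regarded as a polynomial function on $\mathfrak g$ with partial derivatives $\partial_iF$ along $e_i$, put $$\widehat F=d^2F(\{X,Y\})(X\otimes Y)=\sum_{i,j}(\partial_i\partial_jF)(\{X,Y\})\,x_iy_j\in B\otimes B .$$ Let $(p_i)_{i\in I}$ be any family of homogeneous elements generating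 the algebra $S(\mathfrak g^*)^{\mathfrak g}$ of invariant polynomials (for instance $r=\operatorname{rank}\mathfrak g$ homogeneous generators $p_1,\dots,p_r$). Then $\widehat p_i\in E$ for all $i$; let $P\subset E$ be the linear span of the $\widehat p_i$. Let $\rho:\mathfrak g\to\operatorname{End}V$ be a finite dimensional representation and let $w$ be a non-empty word in two letters. Let $w(X,Y)\in(B\otimes B)\otimes\operatorname{End}V$ be the product obtained by substituting $\sum_i x_i\otimes\rho(e_i)$ and $\sum_i y_i\otimes\rho(e_i)$ for the two letters, and let $\mathrm{Tr}_V=\mathrm{id}\otimes\mathrm{tr}$. Then $Q(X,Y)=\mathrm{Tr}_V(w(X,Y))$ belongs to $E$, and $Q\in P$. -/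

import Mathlib

open Module

noncomputable section

namespace CDSW

/-! ### Generic elements, brackets and second differentials

Throughout, `𝔤` is a finite dimensional complex Lie algebra with basis `e i`, and `ε i` is the dual
basis. A "point of `𝔤` with coordinates in a `ℂ`-algebra `A`" is a linear map `u : 𝔤* → A`; it
stands for `∑ i, u (ε i) ⊗ e i` in `A ⊗ 𝔤`. None of the sums below depends on the basis. -/

section Basic

variable {𝔤 : Type*} [LieRing 𝔤] [LieAlgebra ℂ 𝔤] [FiniteDimensional ℂ 𝔤]

/-- A basis of `𝔤`. -/
abbrev e (𝔤 : Type*) [LieRing 𝔤] [LieAlgebra ℂ 𝔤] [FiniteDimensional ℂ 𝔤] :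
    Basis (Fin (finrank ℂ 𝔤)) ℂ 𝔤 :=
  finBasis ℂ 𝔤

/-- The dual basis of `𝔤*`. -/
abbrev ε (𝔤 : Type*) [LieRing 𝔤] [LieAlgebra ℂ 𝔤] [FiniteDimensional ℂ 𝔤]
    (i : Fin (finrank ℂ 𝔤)) : Dual ℂ 𝔤 :=
  (e 𝔤).coord i

variable {A : Type*} [Ring A] [Algebra ℂ A]

/-- The supercommutator `{u, v} = u v + v u` of two odd points of `𝔤`, i.e. the even point
`∑ i j, u (ε i) * v (ε j) ⊗ ⁅e i, e j⁆`, given through its coordinates. -/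
def superBracket (u v : Dual ℂ 𝔤 →ₗ[ℂ] A) : Dual ℂ 𝔤 →ₗ[ℂ] A where
  toFun φ := ∑ i, ∑ j, φ ⁅e 𝔤 i, e 𝔤 j⁆ • (u (ε 𝔤 i) * v (ε 𝔤 j))
  map_add' φ ψ := by simp [add_smul, Finset.sum_add_distrib]
  map_smul' c φ := by simp [mul_smul, Finset.smul_sum]

/-- A sum over a basis and its dual basis does not see where an endomorphism of `𝔤` is placed. -/
lemma sum_coadjoint {W : Type*} [AddCommGroup W] [Module ℂ W] (x : 𝔤)
    (β : 𝔤 →ₗ[ℂ] Dual ℂ 𝔤 →ₗ[ℂ] W) :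
    ∑ i, β (e 𝔤 i) ⁅x, ε 𝔤 i⁆ = - ∑ i, β ⁅x, e 𝔤 i⁆ (ε 𝔤 i) := by
  have h1 : ∀ i, ⁅x, ε 𝔤 i⁆ = - ∑ k, (ε 𝔤 i ⁅x, e 𝔤 k⁆) • ε 𝔤 k := by
    intro i
    refine (e 𝔤).ext fun l => ?_
    simp [Module.Dual.lie_apply, Finsupp.single_apply]
  have h2 : ∀ i, ⁅x, e 𝔤 i⁆ = ∑ k, (ε 𝔤 k ⁅x, e 𝔤 i⁆) • e 𝔤 k := by
    intro i
    simp
  have h3 : ∀ i, β ⁅x, e 𝔤 i⁆ (ε 𝔤 i) = ∑ k, (ε 𝔤 k ⁅x, e 𝔤 i⁆) • β (e 𝔤 k) (ε 𝔤 i) := by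
    intro i
    conv_lhs => rw [h2 i]
    simp only [map_sum, map_smul, LinearMap.sum_apply, LinearMap.smul_apply]
  simp only [h1, h3, map_neg, map_sum, map_smul, Finset.sum_neg_distrib]
  rw [Finset.sum_comm]

/-- Equivariance of the supercommutator. -/
lemma superBracket_lie (x : 𝔤) (u v : Dual ℂ 𝔤 →ₗ[ℂ] A) (φ : Dual ℂ 𝔤) :
    ∑ i, ∑ j, φ ⁅e 𝔤 i, e 𝔤 j⁆ • (u ⁅x, ε 𝔤 i⁆ * v (ε 𝔤 j) + u (ε 𝔤 i) * v ⁅x, ε 𝔤 j⁆)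
      = superBracket u v ⁅x, φ⁆ := by
  have key1 : ∀ j, ∑ i, φ ⁅e 𝔤 i, e 𝔤 j⁆ • (u ⁅x, ε 𝔤 i⁆ * v (ε 𝔤 j))
      = - ∑ i, φ ⁅⁅x, e 𝔤 i⁆, e 𝔤 j⁆ • (u (ε 𝔤 i) * v (ε 𝔤 j)) := by
    intro j
    exact sum_coadjoint x (LinearMap.mk₂ ℂ (fun a ψ => φ ⁅a, e 𝔤 j⁆ • (u ψ * v (ε 𝔤 j)))
      (by intros; simp [add_smul]) (by intros; simp [mul_smul])
      (by intros; simp [add_mul])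
      (by intros; simp only [map_smul, smul_mul_assoc]; rw [smul_comm]))
  have key2 : ∀ i, ∑ j, φ ⁅e 𝔤 i, e 𝔤 j⁆ • (u (ε 𝔤 i) * v ⁅x, ε 𝔤 j⁆)
      = - ∑ j, φ ⁅e 𝔤 i, ⁅x, e 𝔤 j⁆⁆ • (u (ε 𝔤 i) * v (ε 𝔤 j)) := by
    intro i
    exact sum_coadjoint x (LinearMap.mk₂ ℂ (fun a ψ => φ ⁅e 𝔤 i, a⁆ • (u (ε 𝔤 i) * v ψ))
      (by intros; simp [add_smul]) (by intros; simp [mul_smul])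
      (by intros; simp [mul_add])
      (by intros; simp only [map_smul, mul_smul_comm]; rw [smul_comm]))
  simp only [smul_add, Finset.sum_add_distrib]
  rw [Finset.sum_comm, Finset.sum_congr rfl fun j _ => key1 j,
    Finset.sum_congr rfl fun i _ => key2 i]
  simp only [superBracket, LinearMap.coe_mk, AddHom.coe_mk, Module.Dual.lie_apply,
    leibniz_lie x, map_add, neg_smul, add_smul, Finset.sum_neg_distrib, Finset.sum_add_distrib]
  rw [Finset.sum_comm]
  abel

end Basic

/-! ### The algebra `B ⊗ B` and its invariants -/

section Functions

variable (𝔤 : Type*) [LieRing 𝔤] [LieAlgebra ℂ 𝔤] [FiniteDimensional ℂ 𝔤]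

/-- The algebra `R = ⋀(𝔤* ⊕ 𝔤*)` of functions of a pair `(X, Y)` of odd points of `𝔤`. -/
abbrev R : Type _ := ExteriorAlgebra ℂ (Dual ℂ 𝔤 × Dual ℂ 𝔤)

/-- The coordinates of `X` in `R`. -/
def xR : Dual ℂ 𝔤 →ₗ[ℂ] R 𝔤 := ExteriorAlgebra.ι ℂ ∘ₗ LinearMap.inl ℂ (Dual ℂ 𝔤) (Dual ℂ 𝔤)

/-- The coordinates of `Y` in `R`. -/
def yR : Dual ℂ 𝔤 →ₗ[ℂ] R 𝔤 := ExteriorAlgebra.ι ℂ ∘ₗ LinearMap.inr ℂ (Dual ℂ 𝔤) (Dual ℂ 𝔤)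

/-- The relations `{X, X} = 0` and `{Y, Y} = 0`. -/
inductive Rel : R 𝔤 → R 𝔤 → Prop
  | xx (φ : Dual ℂ 𝔤) : Rel (superBracket (xR 𝔤) (xR 𝔤) φ) 0
  | yy (φ : Dual ℂ 𝔤) : Rel (superBracket (yR 𝔤) (yR 𝔤) φ) 0

/-- The algebra `B ⊗ B` (tensor product of superalgebras), where `B` is the quotient of `⋀ 𝔤*` by
the relation `{X, X} = 0`: the quotient of `⋀(𝔤* ⊕ 𝔤*) = ⋀ 𝔤* ⊗ ⋀ 𝔤*` by the two-sided ideal of the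
relations `{X, X} = 0` and `{Y, Y} = 0`. -/
abbrev BB : Type _ := RingQuot (Rel 𝔤)

/-- The projection `R → B ⊗ B`. -/
abbrev mk : R 𝔤 →ₐ[ℂ] BB 𝔤 := RingQuot.mkAlgHom ℂ (Rel 𝔤)

/-- The coordinates of `X` in `B ⊗ B`. -/
def x : Dual ℂ 𝔤 →ₗ[ℂ] BB 𝔤 := (mk 𝔤).toLinearMap ∘ₗ xR 𝔤

/-- The coordinates of `Y` in `B ⊗ B`. -/
def y : Dual ℂ 𝔤 →ₗ[ℂ] BB 𝔤 := (mk 𝔤).toLinearMap ∘ₗ yR 𝔤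

variable {𝔤}

/-- The degree one part of `B ⊗ B`. -/
def gen : Dual ℂ 𝔤 × Dual ℂ 𝔤 →ₗ[ℂ] BB 𝔤 := (mk 𝔤).toLinearMap ∘ₗ ExteriorAlgebra.ι ℂ

lemma gen_anticomm (a b : Dual ℂ 𝔤 × Dual ℂ 𝔤) : gen a * gen b = - (gen b * gen a) := by
  have h : ∀ c : Dual ℂ 𝔤 × Dual ℂ 𝔤, gen c * gen c = 0 := by
    intro c
    simp [gen, ← map_mul]
  have := h (a + b)
  simp only [map_add, add_mul, mul_add, h, zero_add, add_zero] at this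
  exact eq_neg_of_add_eq_zero_right this

lemma x_eq_gen (φ : Dual ℂ 𝔤) : x 𝔤 φ = gen (φ, 0) := rfl

lemma y_eq_gen (φ : Dual ℂ 𝔤) : y 𝔤 φ = gen (0, φ) := rfl

lemma map_superBracket {A C : Type*} [Ring A] [Algebra ℂ A] [Ring C] [Algebra ℂ C]
    (f : A →ₐ[ℂ] C) (u v : Dual ℂ 𝔤 →ₗ[ℂ] A) (φ : Dual ℂ 𝔤) :
    f (superBracket u v φ)
      = superBracket (f.toLinearMap ∘ₗ u) (f.toLinearMap ∘ₗ v) φ := by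
  simp [superBracket]

lemma superBracket_x_x (φ : Dual ℂ 𝔤) : superBracket (x 𝔤) (x 𝔤) φ = 0 := by
  have := RingQuot.mkAlgHom_rel ℂ (Rel.xx φ)
  rwa [map_superBracket, map_zero] at this

lemma superBracket_y_y (φ : Dual ℂ 𝔤) : superBracket (y 𝔤) (y 𝔤) φ = 0 := by
  have := RingQuot.mkAlgHom_rel ℂ (Rel.yy φ)
  rwa [map_superBracket, map_zero] at this

/-- The degree one part of `1 + ε D`, where `D` is the derivation by which `z : 𝔤` acts. -/
def actGen (z : 𝔤) : Dual ℂ 𝔤 × Dual ℂ 𝔤 →ₗ[ℂ] DualNumber (BB 𝔤) where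
  toFun a := TrivSqZeroExt.inl (gen a) + TrivSqZeroExt.inr (gen (⁅z, a.1⁆, ⁅z, a.2⁆))
  map_add' a b := by
    ext
    · simp
    · simp [← map_add]
  map_smul' c a := by
    ext
    · simp
    · have h : ((⁅z, c • a.1⁆, ⁅z, c • a.2⁆) : Dual ℂ 𝔤 × Dual ℂ 𝔤)
          = c • (⁅z, a.1⁆, ⁅z, a.2⁆) := by simp
      simp [h, -lie_smul, -Prod.smul_mk]

lemma superBracket_dual (z : 𝔤) (i : Dual ℂ 𝔤 →ₗ[ℂ] Dual ℂ 𝔤 × Dual ℂ 𝔤)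
    (hi : ∀ φ, ((⁅z, (i φ).1⁆, ⁅z, (i φ).2⁆) : Dual ℂ 𝔤 × Dual ℂ 𝔤) = i ⁅z, φ⁆)
    (h0 : ∀ φ, superBracket (gen ∘ₗ i) (gen ∘ₗ i) φ = 0) (φ : Dual ℂ 𝔤) :
    superBracket (actGen z ∘ₗ i) (actGen z ∘ₗ i) φ = 0 := by
  ext
  · have := h0 φ
    simpa [superBracket, actGen, TrivSqZeroExt.fst_sum] using this
  · have h := superBracket_lie z (gen ∘ₗ i) (gen ∘ₗ i) φ
    rw [h0] at h
    simp only [LinearMap.comp_apply] at h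
    simp only [superBracket, actGen, LinearMap.coe_mk, AddHom.coe_mk, LinearMap.comp_apply, hi,
      TrivSqZeroExt.snd_sum, TrivSqZeroExt.snd_smul, TrivSqZeroExt.snd_zero,
      DualNumber.snd_mul, TrivSqZeroExt.fst_add, TrivSqZeroExt.snd_add, TrivSqZeroExt.fst_inl,
      TrivSqZeroExt.fst_inr, TrivSqZeroExt.snd_inl, TrivSqZeroExt.snd_inr, add_zero, zero_add]
    rw [← h]
    exact Finset.sum_congr rfl fun _ _ => Finset.sum_congr rfl fun _ _ => by rw [add_comm]

/-- The algebra map `1 + ε D` from `R` to the dual numbers over `B ⊗ B`. -/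
def actLiftR (z : 𝔤) : R 𝔤 →ₐ[ℂ] DualNumber (BB 𝔤) :=
  ExteriorAlgebra.lift ℂ ⟨actGen z, fun a => by
    have h : ∀ c : Dual ℂ 𝔤 × Dual ℂ 𝔤, gen c * gen c = 0 := by
      intro c
      simp [gen, ← map_mul]
    ext
    · simp [actGen, h]
    · simp only [actGen, LinearMap.coe_mk, AddHom.coe_mk, DualNumber.snd_mul,
        TrivSqZeroExt.fst_add, TrivSqZeroExt.snd_add, TrivSqZeroExt.fst_inl,
        TrivSqZeroExt.fst_inr, TrivSqZeroExt.snd_inl, TrivSqZeroExt.snd_inr, add_zero, zero_add,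
        TrivSqZeroExt.snd_zero]
      rw [gen_anticomm]
      simp⟩

/-- The algebra map `1 + ε D` from `B ⊗ B` to the dual numbers over `B ⊗ B`. -/
def actLift (z : 𝔤) : BB 𝔤 →ₐ[ℂ] DualNumber (BB 𝔤) :=
  RingQuot.liftAlgHom ℂ ⟨actLiftR z, fun a b h => by
    have hc : (actLiftR z).toLinearMap ∘ₗ ExteriorAlgebra.ι ℂ = actGen z := by
      refine LinearMap.ext fun a => ?_
      simp [actLiftR]
    cases h with
    | xx φ =>
      rw [map_superBracket, map_zero]
      have : (actLiftR z).toLinearMap ∘ₗ xR 𝔤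
          = actGen z ∘ₗ LinearMap.inl ℂ (Dual ℂ 𝔤) (Dual ℂ 𝔤) := by
        rw [← hc]; rfl
      rw [this]
      exact superBracket_dual z _ (fun φ => by simp) superBracket_x_x φ
    | yy φ =>
      rw [map_superBracket, map_zero]
      have : (actLiftR z).toLinearMap ∘ₗ yR 𝔤
          = actGen z ∘ₗ LinearMap.inr ℂ (Dual ℂ 𝔤) (Dual ℂ 𝔤) := by
        rw [← hc]; rfl
      rw [this]
      exact superBracket_dual z _ (fun φ => by simp) superBracket_y_y φ⟩

/-- The action of `z : 𝔤` on `B ⊗ B`: the (even) derivation extending the coadjoint action of `z`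
on the coordinates of `X` and of `Y`; see `act_mul`, `act_x`, `act_y`. -/
def act (z : 𝔤) : BB 𝔤 →ₗ[ℂ] BB 𝔤 :=
  (TrivSqZeroExt.sndHom (BB 𝔤) (BB 𝔤)).restrictScalars ℂ ∘ₗ (actLift z).toLinearMap

lemma actLift_gen (z : 𝔤) (a : Dual ℂ 𝔤 × Dual ℂ 𝔤) : actLift z (gen a) = actGen z a := by
  simp [actLift, gen, actLiftR]

lemma fst_actLift (z : 𝔤) (a : BB 𝔤) : (actLift z a).fst = a := by
  have : (TrivSqZeroExt.fstHom ℂ (BB 𝔤) (BB 𝔤)).comp (actLift z) = AlgHom.id ℂ (BB 𝔤) := by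
    apply RingQuot.ringQuot_ext'
    apply ExteriorAlgebra.hom_ext
    refine LinearMap.ext fun a => ?_
    have := actLift_gen z a
    simp only [gen, LinearMap.comp_apply, AlgHom.toLinearMap_apply] at this
    simp [this, actGen, gen]
  exact DFunLike.congr_fun this a

lemma act_mul (z : 𝔤) (a b : BB 𝔤) : act z (a * b) = act z a * b + a * act z b := by
  simp [act, fst_actLift, add_comm]

lemma act_x (z : 𝔤) (φ : Dual ℂ 𝔤) : act z (x 𝔤 φ) = x 𝔤 ⁅z, φ⁆ := by
  simp [act, x_eq_gen, actLift_gen, actGen]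

lemma act_y (z : 𝔤) (φ : Dual ℂ 𝔤) : act z (y 𝔤 φ) = y 𝔤 ⁅z, φ⁆ := by
  simp [act, y_eq_gen, actLift_gen, actGen]

variable (𝔤) in
/-- The space `E = (B ⊗ B)^𝔤` of invariants. -/
def E : Submodule ℂ (BB 𝔤) := ⨅ z : 𝔤, LinearMap.ker (act z)

end Functions

/-! ### Invariant polynomials and the elements `hat F` -/

section Polynomials

variable (𝔤 : Type*) [LieRing 𝔤] [LieAlgebra ℂ 𝔤]

/-- The algebra `S(𝔤*)` of polynomial functions on `𝔤`. -/
abbrev S : Type _ := SymmetricAlgebra ℂ (Dual ℂ 𝔤)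

variable {𝔤}

/-- The derivation of `S(𝔤*)` with prescribed values on `𝔤*`. -/
def symDer (f : Dual ℂ 𝔤 →ₗ[ℂ] S 𝔤) : Derivation ℂ (S 𝔤) (S 𝔤) :=
  let T : S 𝔤 →ₐ[ℂ] DualNumber (S 𝔤) := SymmetricAlgebra.lift
    ((TrivSqZeroExt.inlAlgHom ℂ (S 𝔤) (S 𝔤)).toLinearMap ∘ₗ SymmetricAlgebra.ι ℂ (Dual ℂ 𝔤)
      + (TrivSqZeroExt.inrHom (S 𝔤) (S 𝔤)).restrictScalars ℂ ∘ₗ f)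
  have hT : ∀ a, (T a).fst = a := fun a => by
    have : (TrivSqZeroExt.fstHom ℂ (S 𝔤) (S 𝔤)).comp T = AlgHom.id ℂ (S 𝔤) := by
      apply SymmetricAlgebra.algHom_ext
      ext1 φ
      simp [T]
    exact DFunLike.congr_fun this a
  Derivation.mk' ((TrivSqZeroExt.sndHom (S 𝔤) (S 𝔤)).restrictScalars ℂ ∘ₗ T.toLinearMap) fun a b => by
    simp [hT, mul_comm]

lemma symDer_ι (f : Dual ℂ 𝔤 →ₗ[ℂ] S 𝔤) (φ : Dual ℂ 𝔤) :
    symDer f (SymmetricAlgebra.ι ℂ _ φ) = f φ := by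
  simp [symDer]

/-- The directional derivative `∂_v` of polynomial functions, `v : 𝔤`. -/
def partialDer (v : 𝔤) : Derivation ℂ (S 𝔤) (S 𝔤) :=
  symDer ((Algebra.linearMap ℂ (S 𝔤)) ∘ₗ Dual.eval ℂ 𝔤 v)

/-- The action of `z : 𝔤` on `S(𝔤*)` extending the coadjoint action. -/
def symAct (z : 𝔤) : Derivation ℂ (S 𝔤) (S 𝔤) :=
  symDer (SymmetricAlgebra.ι ℂ (Dual ℂ 𝔤) ∘ₗ (LieModule.toEnd ℂ 𝔤 (Dual ℂ 𝔤) z))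

variable (𝔤) in
/-- The algebra `S(𝔤*)^𝔤` of invariant polynomials. -/
def invariants : Subalgebra ℂ (S 𝔤) where
  carrier := {F | ∀ z : 𝔤, symAct z F = 0}
  mul_mem' {a b} ha hb z := by simp [ha z, hb z]
  add_mem' {a b} ha hb z := by simp [ha z, hb z]
  algebraMap_mem' c z := by simp

/-- `F` is homogeneous of degree `k`. -/
def IsHomogeneous (F : S 𝔤) (k : ℕ) : Prop :=
  F ∈ (LinearMap.range (SymmetricAlgebra.ι ℂ (Dual ℂ 𝔤))) ^ k

variable [FiniteDimensional ℂ 𝔤]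

lemma superBracket_x_y_commute (φ ψ : Dual ℂ 𝔤) :
    Commute (superBracket (x 𝔤) (y 𝔤) φ) (superBracket (x 𝔤) (y 𝔤) ψ) := by
  have h : ∀ a b c d : Dual ℂ 𝔤 × Dual ℂ 𝔤, Commute (gen a * gen b) (gen c * gen d) := by
    have h2 : ∀ a b c : Dual ℂ 𝔤 × Dual ℂ 𝔤, Commute (gen a * gen b) (gen c) := by
      intro a b c
      change gen a * gen b * gen c = gen c * (gen a * gen b)
      rw [mul_assoc, gen_anticomm b c, mul_neg, ← mul_assoc, gen_anticomm a c, neg_mul, neg_neg,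
        mul_assoc]
    intro a b c d
    exact (h2 a b c).mul_right (h2 a b d)
  simp only [superBracket, LinearMap.coe_mk, AddHom.coe_mk, x_eq_gen, y_eq_gen]
  refine Commute.sum_left _ _ _ fun i _ => Commute.sum_left _ _ _ fun j _ => ?_
  refine Commute.sum_right _ _ _ fun k _ => Commute.sum_right _ _ _ fun l _ => ?_
  exact ((h _ _ _ _).smul_left _).smul_right _

/-- Evaluation `F ↦ F({X, Y})` of polynomials at the even point `{X, Y}`; its coordinates commute
with each other. See `evalXY_ι`. -/
def evalXY : S 𝔤 →ₐ[ℂ] BB 𝔤 :=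
  RingCon.liftₐ (TensorAlgebra.symRingCon ℂ (Dual ℂ 𝔤))
    (TensorAlgebra.lift ℂ (superBracket (x 𝔤) (y 𝔤))) (by
      refine RingCon.ringConGen_le.2 (fun a b h => ?_)
      induction h with | mul_comm φ ψ
      rw [RingCon.ker_apply]
      simpa using (superBracket_x_y_commute φ ψ).eq)

lemma evalXY_ι (φ : Dual ℂ 𝔤) :
    evalXY (SymmetricAlgebra.ι ℂ _ φ) = superBracket (x 𝔤) (y 𝔤) φ :=
  TensorAlgebra.lift_ι_apply (superBracket (x 𝔤) (y 𝔤)) φ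

/-- `hat F (X, Y) = d²F({X, Y})(X ⊗ Y) = ∑ i j, (∂ᵢ ∂ⱼ F)({X, Y}) xᵢ yⱼ`. -/
def hat (F : S 𝔤) : BB 𝔤 :=
  ∑ i, ∑ j, evalXY (partialDer (e 𝔤 i) (partialDer (e 𝔤 j) F)) * (x 𝔤 (ε 𝔤 i) * y 𝔤 (ε 𝔤 j))

end Polynomials

/-! ### Traces of words -/

section Words

open TensorProduct

variable {𝔤 : Type*} [LieRing 𝔤] [LieAlgebra ℂ 𝔤] [FiniteDimensional ℂ 𝔤]
  (V : Type*) [AddCommGroup V] [Module ℂ V] [LieRingModule 𝔤 V] [LieModule ℂ 𝔤 V]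

/-- The two letters. -/
inductive Letter
  | X
  | Y

/-- The coordinates of `X`, resp. of `Y`. -/
def Letter.coords (𝔤 : Type*) [LieRing 𝔤] [LieAlgebra ℂ 𝔤] [FiniteDimensional ℂ 𝔤] :
    Letter → Dual ℂ 𝔤 →ₗ[ℂ] BB 𝔤
  | .X => x 𝔤
  | .Y => y 𝔤

/-- The point `X`, resp. `Y`, acting in the representation `V`: the element
`∑ i, xᵢ ⊗ ρ(eᵢ)`, resp. `∑ i, yᵢ ⊗ ρ(eᵢ)`, of `(B ⊗ B) ⊗ End V`. -/
def letterV (l : Letter) : BB 𝔤 ⊗[ℂ] Module.End ℂ V :=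
  ∑ i, l.coords 𝔤 (ε 𝔤 i) ⊗ₜ[ℂ] LieModule.toEnd ℂ 𝔤 V (e 𝔤 i)

/-- The product `w(X, Y)` in the algebra `(B ⊗ B) ⊗ End V`. -/
def wordV (w : List Letter) : BB 𝔤 ⊗[ℂ] Module.End ℂ V := (w.map (letterV V)).prod

/-- The trace `Tr_V : (B ⊗ B) ⊗ End V → B ⊗ B`. -/
def trV : BB 𝔤 ⊗[ℂ] Module.End ℂ V →ₗ[ℂ] BB 𝔤 :=
  (TensorProduct.rid ℂ (BB 𝔤)).toLinearMap ∘ₗ (LinearMap.trace ℂ V).lTensor (BB 𝔤)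

variable (𝔤) in
/-- The element `Tr_V(w(X, Y))`. -/
def wordTrace (w : List Letter) : BB 𝔤 := trV V (wordV V w)

end Words

end CDSW

end

/-!
Write `Z = {X, Y}`, and let `F` be an invariant polynomial.

*Invariant polynomials.* The relation `{X, X} = 0` and the Jacobi identity give `[X, Z] = 0`
(`lie_X_bracket`). Differentiating the invariance of `F` once and pairing it with `X` and `Y` gives
`∑ i, (∂ᵢ F)(Z) Zᵢ = d²F(Z)([X, Z], Y) = 0`, hence `F(Z) = 0` by Euler's identity if `F` is
homogeneous of positive degree. Differentiating twice and pairing with `X`, `Y`, `X`, one finds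
that `d²F(Z)(Z, X)` is a sum of terms that contain `[X, Z]` or `{X, X}`, so that `dF(Z)(X) = 0` if
the degree is not `1`; in degree `1` there are no invariants, because `𝔤` is perfect
(`diffX_eq_zero`). By the product rule `hat_mul`, the map `F ↦ hat F` on the invariants is then a
derivation over the augmentation. It kills constants and products of elements without constant
term, so its image is spanned by the images of any homogeneous generators
(`hat_mem_span_of_invariant`).

*Words.* In `(B ⊗ B) ⊗ End V` the relations read `X² = Y² = 0`, and `Z` becomes `XY + YX`, which
commutes with `X`. A nonzero word is therefore alternating. The trace is cyclic up to the sign rule,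
so alternating words of odd length at least `3` have trace zero, and
`Tr_V ((YX)ⁿ) = -Tr_V ((XY)ⁿ)`; a single letter has trace zero as `𝔤` is perfect. Finally, for the
invariant polynomial `F(z) = tr_V (ρ(z)ⁿ⁺¹)` the power rule gives
`hat F = (n + 1) n Tr_V (Zⁿ⁻¹ X Y) = (n + 1) n Tr_V ((XY)ⁿ)` (`hat_tracePower`). So every trace of a
nonempty word is a multiple of some `hat F`, and the first part applies. Invariance of the trace
follows from the equivariance of `hat` (`act_hat`).
-/

namespace CDSW

/-! ### Differential calculus in `S(𝔤*)` -/

section Calculus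

variable {𝔤 : Type*} [LieRing 𝔤] [LieAlgebra ℂ 𝔤]

lemma partialDer_ι (v : 𝔤) (φ : Dual ℂ 𝔤) :
    partialDer v (SymmetricAlgebra.ι ℂ _ φ) = algebraMap ℂ (S 𝔤) (φ v) := by
  simp [partialDer, symDer_ι]

lemma symAct_ι (z : 𝔤) (φ : Dual ℂ 𝔤) :
    symAct z (SymmetricAlgebra.ι ℂ _ φ) = SymmetricAlgebra.ι ℂ _ ⁅z, φ⁆ := by
  simp [symAct, symDer_ι]

lemma derivation_ext_ι {D D' : Derivation ℂ (S 𝔤) (S 𝔤)}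
    (h : ∀ φ, D (SymmetricAlgebra.ι ℂ _ φ) = D' (SymmetricAlgebra.ι ℂ _ φ)) : D = D' := by
  ext F
  induction F using SymmetricAlgebra.induction with
  | algebraMap r => simp
  | ι φ => exact h φ
  | mul a b ha hb => simp [ha, hb]
  | add a b ha hb => simp [ha, hb]

lemma partialDer_comm (a b : 𝔤) (F : S 𝔤) :
    partialDer a (partialDer b F) = partialDer b (partialDer a F) := by
  have h : ⁅partialDer a, partialDer b⁆ = 0 := derivation_ext_ι fun φ => by
    simp [Derivation.commutator_apply, partialDer_ι]
  simpa [Derivation.commutator_apply, sub_eq_zero] using DFunLike.congr_fun h F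

lemma symAct_partialDer (z v : 𝔤) (F : S 𝔤) :
    symAct z (partialDer v F) = partialDer v (symAct z F) + partialDer ⁅z, v⁆ F := by
  have h : ⁅symAct z, partialDer v⁆ = partialDer ⁅z, v⁆ := derivation_ext_ι fun φ => by
    simp [Derivation.commutator_apply, partialDer_ι, symAct_ι, Module.Dual.lie_apply]
  rw [← h, Derivation.commutator_apply]
  abel

/-- The directional derivative, as a linear function of the direction. -/
def partialDerLin (F : S 𝔤) : 𝔤 →ₗ[ℂ] S 𝔤 where
  toFun v := partialDer v F
  map_add' v w := by
    have h : partialDer (v + w) = partialDer v + partialDer w := derivation_ext_ι fun φ => by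
      simp [partialDer_ι]
    simp [h]
  map_smul' c v := by
    have h : partialDer (c • v) = c • partialDer v := derivation_ext_ι fun φ => by
      simp [partialDer_ι, Algebra.smul_def]
    simp [h]

lemma partialDerLin_apply (F : S 𝔤) (v : 𝔤) : partialDerLin F v = partialDer v F := rfl

variable [FiniteDimensional ℂ 𝔤]

/-- Chain rule: a derivation of `S(𝔤*)` is determined by the derivatives of the coordinates. -/
lemma derivation_eq_sum (D : Derivation ℂ (S 𝔤) (S 𝔤)) (F : S 𝔤) :
    D F = ∑ i, partialDer (e 𝔤 i) F * D (SymmetricAlgebra.ι ℂ _ (ε 𝔤 i)) := by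
  let D' : Derivation ℂ (S 𝔤) (S 𝔤) :=
    ∑ i, D (SymmetricAlgebra.ι ℂ _ (ε 𝔤 i)) • partialDer (e 𝔤 i)
  have hD' : ∀ G, D' G = ∑ i, partialDer (e 𝔤 i) G * D (SymmetricAlgebra.ι ℂ _ (ε 𝔤 i)) := by
    intro G
    simp only [D', ← Derivation.coeFnAddMonoidHom_apply, map_sum, Finset.sum_apply]
    exact Finset.sum_congr rfl fun i _ => by
      simp [Derivation.coeFnAddMonoidHom_apply, mul_comm]
  have h : D = D' := derivation_ext_ι fun φ => by
    have hφ : φ = ∑ i, φ (e 𝔤 i) • ε 𝔤 i := by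
      refine (e 𝔤).ext fun l => ?_
      simp
    rw [hD']
    conv_lhs => rw [hφ]
    simp only [map_sum, LinearMap.map_smul, Derivation.map_smul, partialDer_ι]
    simp only [Algebra.smul_def]
  rw [← hD', ← h]

/-- Euler's identity. -/
lemma euler {F : S 𝔤} {k : ℕ} (hF : IsHomogeneous F k) :
    ∑ i, partialDer (e 𝔤 i) F * SymmetricAlgebra.ι ℂ _ (ε 𝔤 i) = (k : ℂ) • F := by
  have h := derivation_eq_sum (symDer (SymmetricAlgebra.ι ℂ (Dual ℂ 𝔤))) F
  simp only [symDer_ι] at h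
  rw [← h]
  clear h
  unfold IsHomogeneous at hF
  induction hF using Submodule.pow_induction_on_left' with
  | algebraMap r => simp
  | add a b i _ _ ha hb => simp [ha, hb]
  | mem_mul m hm i a _ ha =>
    obtain ⟨φ, rfl⟩ := hm
    simp [ha, symDer_ι, add_smul, mul_comm, add_comm]

/-- The derivative of Euler's identity in the direction `v`. -/
lemma euler_partialDer {F : S 𝔤} {k : ℕ} (hF : IsHomogeneous F k) (v : 𝔤) :
    ∑ i, partialDer v (partialDer (e 𝔤 i) F) * SymmetricAlgebra.ι ℂ _ (ε 𝔤 i)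
      = ((k : ℂ) - 1) • partialDer v F := by
  have h := congrArg (partialDer v) (euler hF)
  simp only [map_sum, Derivation.leibniz, partialDer_ι, Finset.sum_add_distrib,
    Derivation.map_smul, smul_eq_mul] at h
  have h2 : ∑ i, partialDer (e 𝔤 i) F * algebraMap ℂ (S 𝔤) (ε 𝔤 i v) = partialDer v F := by
    rw [derivation_eq_sum (partialDer v)]
    simp only [partialDer_ι]
  rw [h2] at h
  rw [sub_smul, one_smul, ← h, add_sub_cancel_left]
  exact Finset.sum_congr rfl fun i _ => mul_comm _ _

lemma partialDer_lie (F : S 𝔤) (a b : 𝔤) :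
    partialDer ⁅a, b⁆ F = ∑ i, ε 𝔤 i ⁅a, b⁆ • partialDer (e 𝔤 i) F := by
  conv_lhs => rw [← partialDerLin_apply, ← (e 𝔤).sum_repr ⁅a, b⁆]
  simp [partialDerLin_apply, -Basis.sum_repr]

/-- The derivative in the direction `b` of the invariance of `F` under `a`. -/
lemma invariance_partialDer {F : S 𝔤} (hF : F ∈ invariants 𝔤) (a b : 𝔤) :
    ∑ i, partialDer b (partialDer (e 𝔤 i) F) * SymmetricAlgebra.ι ℂ _ ⁅a, ε 𝔤 i⁆
      = ∑ i, ε 𝔤 i ⁅a, b⁆ • partialDer (e 𝔤 i) F := by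
  have h := symAct_partialDer a b F
  rw [hF a, map_zero, zero_add, partialDer_lie, derivation_eq_sum (symAct a)] at h
  rw [← h]
  simp only [symAct_ι, partialDer_comm b]

/-- The second derivative of the invariance of `F` under `a`. -/
lemma invariance_partialDer_partialDer {F : S 𝔤} (hF : F ∈ invariants 𝔤) (a b c : 𝔤) :
    ∑ i, partialDer c (partialDer b (partialDer (e 𝔤 i) F)) * SymmetricAlgebra.ι ℂ _ ⁅a, ε 𝔤 i⁆
      = ∑ i, ε 𝔤 i ⁅a, b⁆ • partialDer c (partialDer (e 𝔤 i) F)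
        + ∑ i, ε 𝔤 i ⁅a, c⁆ • partialDer b (partialDer (e 𝔤 i) F) := by
  have h := symAct_partialDer a c (partialDer b F)
  rw [symAct_partialDer a b F, hF a, map_zero, zero_add, partialDer_lie, partialDer_lie,
    derivation_eq_sum (symAct a)] at h
  simp only [map_sum, Derivation.map_smul] at h
  rw [Finset.sum_congr rfl fun i _ => congrArg (_ • ·) (partialDer_comm b (e 𝔤 i) F), ← h]
  refine Finset.sum_congr rfl fun i _ => ?_
  rw [symAct_ι, partialDer_comm (e 𝔤 i) c, partialDer_comm (e 𝔤 i) b]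

end Calculus

/-! ### Simple Lie algebras are perfect -/

section Perfect

variable {𝔤 : Type*} [LieRing 𝔤] [LieAlgebra ℂ 𝔤]

/-- A simple Lie algebra is perfect, so a linear map that kills all brackets vanishes. -/
lemma eq_zero_of_forall_lie [LieAlgebra.IsSimple ℂ 𝔤] {W : Type*} [AddCommGroup W] [Module ℂ W]
    (f : 𝔤 →ₗ[ℂ] W) (hf : ∀ a b : 𝔤, f ⁅a, b⁆ = 0) : f = 0 := by
  have htop : (⁅(⊤ : LieIdeal ℂ 𝔤), (⊤ : LieIdeal ℂ 𝔤)⁆ : LieIdeal ℂ 𝔤) = ⊤ := by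
    refine (LieAlgebra.IsSimple.eq_bot_or_eq_top _).resolve_left fun h => ?_
    refine LieAlgebra.IsSimple.non_abelian (R := ℂ) (L := 𝔤) ⟨fun a b => ?_⟩
    have : ⁅a, b⁆ ∈ (⁅(⊤ : LieIdeal ℂ 𝔤), (⊤ : LieIdeal ℂ 𝔤)⁆ : LieIdeal ℂ 𝔤) :=
      LieSubmodule.lie_mem_lie (LieSubmodule.mem_top a) (LieSubmodule.mem_top b)
    rw [h] at this
    simpa using this
  have hle : (⊤ : Submodule ℂ 𝔤) ≤ LinearMap.ker f := by
    have h2 := congrArg LieSubmodule.toSubmodule htop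
    rw [LieSubmodule.lieIdeal_oper_eq_linear_span', LieSubmodule.top_toSubmodule] at h2
    rw [← h2, Submodule.span_le]
    rintro _ ⟨a, -, b, -, rfl⟩
    exact hf a b
  exact LinearMap.ext fun a => hle (Submodule.mem_top (x := a))

end Perfect

/-! ### Vanishing of `F({X, Y})` and `dF({X, Y})(X)` for invariant `F` -/

section Vanishing

variable {𝔤 : Type*} [LieRing 𝔤] [LieAlgebra ℂ 𝔤] [FiniteDimensional ℂ 𝔤]

/-- `dF({X, Y})(X) = ∑ i, (∂ᵢ F)({X, Y}) xᵢ`. -/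
noncomputable def diffX (F : S 𝔤) : BB 𝔤 :=
  ∑ i, evalXY (partialDer (e 𝔤 i) F) * x 𝔤 (ε 𝔤 i)

lemma x_mul_x (φ ψ : Dual ℂ 𝔤) : x 𝔤 φ * x 𝔤 ψ = -(x 𝔤 ψ * x 𝔤 φ) := gen_anticomm _ _

lemma x_mul_y (φ ψ : Dual ℂ 𝔤) : x 𝔤 φ * y 𝔤 ψ = -(y 𝔤 ψ * x 𝔤 φ) := gen_anticomm _ _

/-- `[X, {X, Y}] = 0`, by the Jacobi identity and `{X, X} = 0`. -/
lemma lie_X_bracket (φ : Dual ℂ 𝔤) :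
    ∑ a, evalXY (SymmetricAlgebra.ι ℂ _ ⁅e 𝔤 a, φ⁆) * x 𝔤 (ε 𝔤 a) = 0 := by
  have h1 : ∀ a b c, (x 𝔤 (ε 𝔤 b) * y 𝔤 (ε 𝔤 c)) * x 𝔤 (ε 𝔤 a)
      = x 𝔤 (ε 𝔤 a) * x 𝔤 (ε 𝔤 b) * y 𝔤 (ε 𝔤 c) := fun a b c => by
    rw [mul_assoc, ← neg_neg (y 𝔤 _ * x 𝔤 _), ← x_mul_y, mul_neg, ← mul_assoc,
      x_mul_x, neg_mul, neg_neg]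
  have hT : ∑ a, evalXY (SymmetricAlgebra.ι ℂ _ ⁅e 𝔤 a, φ⁆) * x 𝔤 (ε 𝔤 a)
      = - ∑ c, ∑ a, ∑ b, φ ⁅e 𝔤 a, ⁅e 𝔤 b, e 𝔤 c⁆⁆ •
        (x 𝔤 (ε 𝔤 a) * x 𝔤 (ε 𝔤 b) * y 𝔤 (ε 𝔤 c)) := by
    simp only [evalXY_ι, superBracket, LinearMap.coe_mk, AddHom.coe_mk, Finset.sum_mul,
      smul_mul_assoc, h1, Module.Dual.lie_apply, neg_smul, neg_mul, Finset.sum_neg_distrib]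
    exact congrArg Neg.neg
      (Finset.sum_comm.trans (Finset.sum_congr rfl fun a _ => Finset.sum_comm)).symm
  have h2 : ∀ c, ∑ a, ∑ b, φ ⁅e 𝔤 a, ⁅e 𝔤 b, e 𝔤 c⁆⁆ •
      (x 𝔤 (ε 𝔤 a) * x 𝔤 (ε 𝔤 b) * y 𝔤 (ε 𝔤 c)) = 0 := by
    intro c
    -- Symmetrize in `a` and `b`: the odd coordinates of `X` anticommute.
    have hs : ∑ a, ∑ b, φ ⁅e 𝔤 a, ⁅e 𝔤 b, e 𝔤 c⁆⁆ • (x 𝔤 (ε 𝔤 a) * x 𝔤 (ε 𝔤 b) * y 𝔤 (ε 𝔤 c))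
        = - ∑ a, ∑ b, φ ⁅e 𝔤 b, ⁅e 𝔤 a, e 𝔤 c⁆⁆ • (x 𝔤 (ε 𝔤 a) * x 𝔤 (ε 𝔤 b) * y 𝔤 (ε 𝔤 c)) := by
      rw [Finset.sum_comm]
      simp only [← Finset.sum_neg_distrib]
      refine Finset.sum_congr rfl fun a _ => Finset.sum_congr rfl fun b _ => ?_
      rw [x_mul_x, neg_mul, smul_neg]
    have hj : ∑ a, ∑ b, φ ⁅⁅e 𝔤 a, e 𝔤 b⁆, e 𝔤 c⁆ •
        (x 𝔤 (ε 𝔤 a) * x 𝔤 (ε 𝔤 b) * y 𝔤 (ε 𝔤 c)) = 0 := by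
      have := congrArg (· * y 𝔤 (ε 𝔤 c)) (superBracket_x_x ⁅e 𝔤 c, φ⁆)
      simp only [superBracket, LinearMap.coe_mk, AddHom.coe_mk, Module.Dual.lie_apply,
        ← lie_skew (e 𝔤 c), map_neg, neg_neg, Finset.sum_mul, smul_mul_assoc, zero_mul] at this
      exact this
    simp only [lie_lie, map_sub, sub_smul, Finset.sum_sub_distrib] at hj
    rw [← sub_eq_zero.mp hj] at hs
    have h4 := eq_neg_iff_add_eq_zero.mp hs
    rw [← two_smul ℂ] at h4
    exact (smul_eq_zero.mp h4).resolve_left two_ne_zero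
  rw [hT, Finset.sum_congr rfl fun c _ => h2 c, Finset.sum_const_zero, neg_zero]

/-- An invariant polynomial of positive degree vanishes at `{X, Y}`. -/
lemma evalXY_eq_zero_of_invariant {F : S 𝔤} (hF : F ∈ invariants 𝔤) {k : ℕ}
    (hk : IsHomogeneous F k) (h0 : k ≠ 0) : evalXY F = 0 := by
  have hc : (k : ℂ) • evalXY F = ∑ i, evalXY (partialDer (e 𝔤 i) F) *
      superBracket (x 𝔤) (y 𝔤) (ε 𝔤 i) := by
    simp only [← evalXY_ι, ← map_mul, ← map_sum, ← euler hk, ← map_smul]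
  have h1 : ∀ a b, ∑ i, ε 𝔤 i ⁅e 𝔤 a, e 𝔤 b⁆ • evalXY (partialDer (e 𝔤 i) F)
      = ∑ i, evalXY (partialDer (e 𝔤 b) (partialDer (e 𝔤 i) F)) *
        evalXY (SymmetricAlgebra.ι ℂ _ ⁅e 𝔤 a, ε 𝔤 i⁆) := fun a b => by
    simp only [← map_mul, ← map_sum, invariance_partialDer hF, ← map_smul]
  have h2 : (k : ℂ) • evalXY F = ∑ a, ∑ b,
      (∑ i, ε 𝔤 i ⁅e 𝔤 a, e 𝔤 b⁆ • evalXY (partialDer (e 𝔤 i) F)) *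
        (x 𝔤 (ε 𝔤 a) * y 𝔤 (ε 𝔤 b)) := by
    rw [hc]
    simp only [superBracket, LinearMap.coe_mk, AddHom.coe_mk, Finset.mul_sum, Finset.sum_mul,
      smul_mul_assoc, mul_smul_comm]
    exact Finset.sum_comm.trans (Finset.sum_congr rfl fun a _ => Finset.sum_comm)
  have h3 : (k : ℂ) • evalXY F = ∑ b, ∑ i,
      evalXY (partialDer (e 𝔤 b) (partialDer (e 𝔤 i) F)) *
        (∑ a, evalXY (SymmetricAlgebra.ι ℂ _ ⁅e 𝔤 a, ε 𝔤 i⁆) * x 𝔤 (ε 𝔤 a)) * y 𝔤 (ε 𝔤 b) := by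
    rw [h2]
    simp only [h1, Finset.mul_sum, Finset.sum_mul, mul_assoc]
    exact Finset.sum_comm.trans (Finset.sum_congr rfl fun a _ => Finset.sum_comm)
  simp only [lie_X_bracket, mul_zero, zero_mul, Finset.sum_const_zero] at h3
  exact (smul_eq_zero.mp h3).resolve_left (Nat.cast_ne_zero.mpr h0)

/-- `d²F(Z)({X, X}, Y) = 0`, in coordinates and with any coefficients in place of those of
`d²F(Z)`. -/
lemma sum_bracket_self (G : Fin (finrank ℂ 𝔤) → Fin (finrank ℂ 𝔤) → BB 𝔤) :
    ∑ c, ∑ a, ∑ b, (∑ i, ε 𝔤 i ⁅e 𝔤 a, e 𝔤 c⁆ • G b i) * (x 𝔤 (ε 𝔤 a) * y 𝔤 (ε 𝔤 b)) * x 𝔤 (ε 𝔤 c)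
      = 0 := by
  have hs : ∀ a b c, x 𝔤 (ε 𝔤 a) * y 𝔤 (ε 𝔤 b) * x 𝔤 (ε 𝔤 c)
      = -(x 𝔤 (ε 𝔤 a) * x 𝔤 (ε 𝔤 c) * y 𝔤 (ε 𝔤 b)) := fun a b c => by
    rw [mul_assoc, mul_assoc, x_mul_y, mul_neg, neg_neg]
  have ht : ∀ a b c,
      (∑ i, ε 𝔤 i ⁅e 𝔤 a, e 𝔤 c⁆ • G b i) * (x 𝔤 (ε 𝔤 a) * y 𝔤 (ε 𝔤 b)) * x 𝔤 (ε 𝔤 c)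
      = - ∑ i, G b i * (ε 𝔤 i ⁅e 𝔤 a, e 𝔤 c⁆ • (x 𝔤 (ε 𝔤 a) * x 𝔤 (ε 𝔤 c))) * y 𝔤 (ε 𝔤 b) :=
    fun a b c => by
      rw [mul_assoc, hs, mul_neg, Finset.sum_mul]
      simp only [smul_mul_assoc, mul_smul_comm, mul_assoc]
  have hb : ∀ b, ∑ a, ∑ c,
      (∑ i, ε 𝔤 i ⁅e 𝔤 a, e 𝔤 c⁆ • G b i) * (x 𝔤 (ε 𝔤 a) * y 𝔤 (ε 𝔤 b)) * x 𝔤 (ε 𝔤 c) = 0 := by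
    intro b
    have hi : ∀ i, ∑ a, ∑ c,
        G b i * (ε 𝔤 i ⁅e 𝔤 a, e 𝔤 c⁆ • (x 𝔤 (ε 𝔤 a) * x 𝔤 (ε 𝔤 c))) * y 𝔤 (ε 𝔤 b) = 0 := by
      intro i
      simp only [← Finset.sum_mul, ← Finset.mul_sum]
      have := superBracket_x_x (ε 𝔤 i)
      simp only [superBracket, LinearMap.coe_mk, AddHom.coe_mk] at this
      rw [this, mul_zero, zero_mul]
    simp only [ht, Finset.sum_neg_distrib, neg_eq_zero]
    rw [Finset.sum_congr rfl fun a _ => Finset.sum_comm, Finset.sum_comm,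
      Finset.sum_congr rfl fun i _ => hi i, Finset.sum_const_zero]
  rw [Finset.sum_comm, Finset.sum_congr rfl fun a _ => Finset.sum_comm, Finset.sum_comm,
    Finset.sum_congr rfl fun b _ => hb b, Finset.sum_const_zero]

/-- By Euler's identity, `(k - 1) dF(Z)(X) = d²F(Z)(Z, X)` where `Z = {X, Y}`, and the second
derivative of the invariance of `F` expresses the right side through `[X, Z]` and `{X, X}`. -/
lemma diffX_eq_zero_of_ne_one {F : S 𝔤} (hF : F ∈ invariants 𝔤) {k : ℕ}
    (hk : IsHomogeneous F k) (h1 : k ≠ 1) : diffX F = 0 := by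
  have hc : ((k : ℂ) - 1) • diffX F = ∑ c, ∑ i,
      evalXY (partialDer (e 𝔤 c) (partialDer (e 𝔤 i) F)) *
        superBracket (x 𝔤) (y 𝔤) (ε 𝔤 i) * x 𝔤 (ε 𝔤 c) := by
    simp only [← evalXY_ι, ← map_mul, ← map_sum, ← Finset.sum_mul, euler_partialDer hk, map_smul,
      diffX, Finset.smul_sum, smul_mul_assoc]
  have h2 : ((k : ℂ) - 1) • diffX F = ∑ c, ∑ a, ∑ b,
      (∑ i, ε 𝔤 i ⁅e 𝔤 a, e 𝔤 b⁆ • evalXY (partialDer (e 𝔤 c) (partialDer (e 𝔤 i) F))) *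
        (x 𝔤 (ε 𝔤 a) * y 𝔤 (ε 𝔤 b)) * x 𝔤 (ε 𝔤 c) := by
    rw [hc]
    simp only [superBracket, LinearMap.coe_mk, AddHom.coe_mk, Finset.mul_sum, Finset.sum_mul,
      smul_mul_assoc, mul_smul_comm]
    exact Finset.sum_congr rfl fun c _ =>
      Finset.sum_comm.trans (Finset.sum_congr rfl fun a _ => Finset.sum_comm)
  have h3 : ∀ a b c,
      ∑ i, ε 𝔤 i ⁅e 𝔤 a, e 𝔤 b⁆ • evalXY (partialDer (e 𝔤 c) (partialDer (e 𝔤 i) F))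
        + ∑ i, ε 𝔤 i ⁅e 𝔤 a, e 𝔤 c⁆ • evalXY (partialDer (e 𝔤 b) (partialDer (e 𝔤 i) F))
      = ∑ i, evalXY (partialDer (e 𝔤 c) (partialDer (e 𝔤 b) (partialDer (e 𝔤 i) F))) *
          evalXY (SymmetricAlgebra.ι ℂ _ ⁅e 𝔤 a, ε 𝔤 i⁆) :=
    fun a b c => by
      simp only [← map_mul, ← map_sum, invariance_partialDer_partialDer hF, ← map_smul, map_add]
  -- The first term contains `[X, {X, Y}]`, the second one `{X, X}`.
  have h4 : ∑ c, ∑ a, ∑ b,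
      (∑ i, evalXY (partialDer (e 𝔤 c) (partialDer (e 𝔤 b) (partialDer (e 𝔤 i) F))) *
          evalXY (SymmetricAlgebra.ι ℂ _ ⁅e 𝔤 a, ε 𝔤 i⁆)) *
        (x 𝔤 (ε 𝔤 a) * y 𝔤 (ε 𝔤 b)) * x 𝔤 (ε 𝔤 c)
      = ∑ c, ∑ b, ∑ i,
        evalXY (partialDer (e 𝔤 c) (partialDer (e 𝔤 b) (partialDer (e 𝔤 i) F))) *
          (∑ a, evalXY (SymmetricAlgebra.ι ℂ _ ⁅e 𝔤 a, ε 𝔤 i⁆) * x 𝔤 (ε 𝔤 a)) *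
          (y 𝔤 (ε 𝔤 b) * x 𝔤 (ε 𝔤 c)) := by
    simp only [Finset.mul_sum, Finset.sum_mul, mul_assoc]
    exact Finset.sum_congr rfl fun c _ =>
      Finset.sum_comm.trans (Finset.sum_congr rfl fun a _ => Finset.sum_comm)
  rw [← add_zero (∑ c, _), ← sum_bracket_self fun b i =>
    evalXY (partialDer (e 𝔤 b) (partialDer (e 𝔤 i) F))] at h2
  simp only [← Finset.sum_add_distrib, ← add_mul, h3] at h2
  rw [h4] at h2
  simp only [lie_X_bracket, mul_zero, zero_mul, Finset.sum_const_zero] at h2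
  refine (smul_eq_zero.mp h2).resolve_left (sub_ne_zero.mpr ?_)
  exact_mod_cast h1

/-- A simple Lie algebra has no invariant linear forms. -/
lemma diffX_eq_zero_of_linear [LieAlgebra.IsSimple ℂ 𝔤] {F : S 𝔤}
    (hF : F ∈ invariants 𝔤) (hk : IsHomogeneous F 1) : diffX F = 0 := by
  rw [IsHomogeneous, pow_one] at hk
  obtain ⟨φ, rfl⟩ := hk
  have hφ : φ = 0 := by
    refine eq_zero_of_forall_lie φ fun a b => ?_
    have h := congrArg (partialDer b) (hF a)
    rw [symAct_ι, partialDer_ι, map_zero, SymmetricAlgebra.algebraMap_eq_zero_iff,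
      Module.Dual.lie_apply, neg_eq_zero] at h
    exact h
  simp [hφ, diffX]

/-- `dF({X, Y})(X) = 0` for every homogeneous invariant polynomial `F`. -/
lemma diffX_eq_zero [LieAlgebra.IsSimple ℂ 𝔤] {F : S 𝔤}
    (hF : F ∈ invariants 𝔤) {k : ℕ} (hk : IsHomogeneous F k) : diffX F = 0 := by
  by_cases h1 : k = 1
  · subst h1
    exact diffX_eq_zero_of_linear hF hk
  · exact diffX_eq_zero_of_ne_one hF hk h1

end Vanishing

/-! ### The map `F ↦ hat F` on invariant polynomials -/

section Hat

variable {𝔤 : Type*} [LieRing 𝔤] [LieAlgebra ℂ 𝔤] [FiniteDimensional ℂ 𝔤]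

lemma hat_add (F G : S 𝔤) : hat (F + G) = hat F + hat G := by
  simp [hat, add_mul, Finset.sum_add_distrib]

lemma diffX_add (F G : S 𝔤) : diffX (F + G) = diffX F + diffX G := by
  simp [diffX, add_mul, Finset.sum_add_distrib]

lemma evalXY_commute (F G : S 𝔤) : evalXY F * evalXY G = evalXY G * evalXY F := by
  rw [← map_mul, mul_comm, map_mul]

lemma diffX_mul (F G : S 𝔤) :
    diffX (F * G) = evalXY F * diffX G + evalXY G * diffX F := by
  simp [diffX, add_mul, Finset.sum_add_distrib, Finset.mul_sum, mul_assoc]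

/-- The product rule for `hat`; the mixed terms contain `dF({X, Y})(X)` and `dG({X, Y})(X)`. -/
lemma hat_mul (F G : S 𝔤) :
    hat (F * G) = evalXY F * hat G + evalXY G * hat F
      + ∑ j, (evalXY (partialDer (e 𝔤 j) G) * diffX F
        + evalXY (partialDer (e 𝔤 j) F) * diffX G) * y 𝔤 (ε 𝔤 j) := by
  have h1 : ∀ i j, evalXY (partialDer (e 𝔤 i) (partialDer (e 𝔤 j) (F * G)))
      * (x 𝔤 (ε 𝔤 i) * y 𝔤 (ε 𝔤 j))
      = evalXY F * (evalXY (partialDer (e 𝔤 i) (partialDer (e 𝔤 j) G))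
          * (x 𝔤 (ε 𝔤 i) * y 𝔤 (ε 𝔤 j)))
        + evalXY G * (evalXY (partialDer (e 𝔤 i) (partialDer (e 𝔤 j) F))
          * (x 𝔤 (ε 𝔤 i) * y 𝔤 (ε 𝔤 j)))
        + (evalXY (partialDer (e 𝔤 j) G) * (evalXY (partialDer (e 𝔤 i) F) * x 𝔤 (ε 𝔤 i))
          + evalXY (partialDer (e 𝔤 j) F) * (evalXY (partialDer (e 𝔤 i) G) * x 𝔤 (ε 𝔤 i)))
          * y 𝔤 (ε 𝔤 j) := by
    intro i j
    simp only [Derivation.leibniz, map_add, smul_eq_mul, map_mul, add_mul, mul_assoc]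
    abel
  simp only [hat, h1, Finset.sum_add_distrib, ← Finset.mul_sum, diffX]
  congr 1
  rw [Finset.sum_comm]
  refine Finset.sum_congr rfl fun j _ => ?_
  rw [← Finset.sum_mul, Finset.sum_add_distrib, Finset.mul_sum, Finset.mul_sum]

/-- If the invariant polynomials are generated by homogeneous elements `p i`, then `hat` maps them
to the span of the `hat (p i)`: on invariant polynomials, `hat` is a derivation over the
augmentation, since `F({X, Y})` is a scalar and `dF({X, Y})(X)` vanishes. -/
lemma hat_mem_span_of_invariant [LieAlgebra.IsSimple ℂ 𝔤] {I : Type*} (p : I → S 𝔤) (d : I → ℕ)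
    (hp : ∀ i, IsHomogeneous (p i) (d i))
    (hgen : Algebra.adjoin ℂ (Set.range p) = invariants 𝔤) {F : S 𝔤} (hF : F ∈ invariants 𝔤) :
    hat F ∈ Submodule.span ℂ (Set.range fun i => hat (p i)) := by
  have hinv : ∀ i, p i ∈ invariants 𝔤 := fun i =>
    hgen ▸ Algebra.subset_adjoin (Set.mem_range_self i)
  suffices h : (∃ c : ℂ, evalXY F = algebraMap ℂ (BB 𝔤) c) ∧ diffX F = 0 ∧
      hat F ∈ Submodule.span ℂ (Set.range fun i => hat (p i)) from h.2.2
  rw [← hgen] at hF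
  induction hF using Algebra.adjoin_induction with
  | mem a ha =>
    obtain ⟨i, rfl⟩ := ha
    refine ⟨?_, diffX_eq_zero (hinv i) (hp i), Submodule.subset_span (Set.mem_range_self i)⟩
    by_cases h0 : d i = 0
    · have h := hp i
      rw [h0, IsHomogeneous, pow_zero, Submodule.mem_one] at h
      obtain ⟨c, hc⟩ := h
      exact ⟨c, by rw [← hc, AlgHom.commutes]⟩
    · exact ⟨0, by rw [evalXY_eq_zero_of_invariant (hinv i) (hp i) h0, map_zero]⟩
  | algebraMap c =>
    exact ⟨⟨c, AlgHom.commutes _ c⟩, by simp [diffX], by simp [hat]⟩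
  | add a b _ _ ha hb =>
    obtain ⟨⟨c, hc⟩, ha1, ha2⟩ := ha
    obtain ⟨⟨c', hc'⟩, hb1, hb2⟩ := hb
    exact ⟨⟨c + c', by rw [map_add, hc, hc', map_add]⟩, by rw [diffX_add, ha1, hb1, add_zero],
      hat_add a b ▸ add_mem ha2 hb2⟩
  | mul a b _ _ ha hb =>
    obtain ⟨⟨c, hc⟩, ha1, ha2⟩ := ha
    obtain ⟨⟨c', hc'⟩, hb1, hb2⟩ := hb
    refine ⟨⟨c * c', by rw [map_mul, hc, hc', map_mul]⟩, by simp [diffX_mul, ha1, hb1], ?_⟩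
    rw [hat_mul, ha1, hb1, hc, hc']
    simp only [mul_zero, add_zero, zero_mul, Finset.sum_const_zero, ← Algebra.smul_def]
    exact add_mem (Submodule.smul_mem _ _ hb2) (Submodule.smul_mem _ _ ha2)

lemma act_evalXY (z : 𝔤) (F : S 𝔤) : act z (evalXY F) = evalXY (symAct z F) := by
  have act_algebraMap : ∀ c : ℂ, act z (algebraMap ℂ (BB 𝔤) c) = 0 := fun c => by
    simp [act, TrivSqZeroExt.algebraMap_eq_inl']
  induction F using SymmetricAlgebra.induction with
  | algebraMap r => simp [act_algebraMap]
  | ι φ =>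
    rw [symAct_ι, evalXY_ι, evalXY_ι, ← superBracket_lie]
    simp only [superBracket, LinearMap.coe_mk, AddHom.coe_mk, map_sum, map_smul, act_mul, act_x,
      act_y]
  | mul a b ha hb =>
    simp only [map_mul, act_mul, ha, hb, Derivation.leibniz, map_add, smul_eq_mul]
    rw [evalXY_commute b, add_comm]
  | add a b ha hb => simp [ha, hb]

lemma act_hat (z : 𝔤) (F : S 𝔤) : act z (hat F) = hat (symAct z F) := by
  have key1 : ∀ j, ∑ i, evalXY (partialDer (e 𝔤 i) (partialDer (e 𝔤 j) F))
        * (x 𝔤 ⁅z, ε 𝔤 i⁆ * y 𝔤 (ε 𝔤 j))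
      = - ∑ i, evalXY (partialDer ⁅z, e 𝔤 i⁆ (partialDer (e 𝔤 j) F))
        * (x 𝔤 (ε 𝔤 i) * y 𝔤 (ε 𝔤 j)) := fun j =>
    sum_coadjoint z (LinearMap.mk₂ ℂ
      (fun a ψ => evalXY (partialDerLin (partialDer (e 𝔤 j) F) a) * (x 𝔤 ψ * y 𝔤 (ε 𝔤 j)))
      (by intros; simp [add_mul]) (by intros; simp)
      (by intros; simp [add_mul, mul_add]) (by intros; simp))
  have key2 : ∀ i, ∑ j, evalXY (partialDer (e 𝔤 i) (partialDer (e 𝔤 j) F))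
        * (x 𝔤 (ε 𝔤 i) * y 𝔤 ⁅z, ε 𝔤 j⁆)
      = - ∑ j, evalXY (partialDer (e 𝔤 i) (partialDer ⁅z, e 𝔤 j⁆ F))
        * (x 𝔤 (ε 𝔤 i) * y 𝔤 (ε 𝔤 j)) := fun i =>
    sum_coadjoint z (LinearMap.mk₂ ℂ
      (fun a ψ => evalXY (partialDer (e 𝔤 i) (partialDerLin F a)) * (x 𝔤 (ε 𝔤 i) * y 𝔤 ψ))
      (by intros; simp [add_mul]) (by intros; simp)
      (by intros; simp [mul_add]) (by intros; simp))
  simp only [hat, map_sum, act_mul, act_x, act_y, mul_add, Finset.sum_add_distrib, act_evalXY,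
    symAct_partialDer, map_add, add_mul, key2]
  rw [Finset.sum_comm (f := fun i j => _ * (x 𝔤 ⁅z, ε 𝔤 i⁆ * y 𝔤 (ε 𝔤 j))),
    Finset.sum_congr rfl fun j _ => key1 j, Finset.sum_neg_distrib, Finset.sum_neg_distrib,
    Finset.sum_comm (f := fun j i => evalXY (partialDer ⁅z, e 𝔤 i⁆ (partialDer (e 𝔤 j) F)) * _)]
  abel

lemma hat_mem_E {F : S 𝔤} (hF : F ∈ invariants 𝔤) : hat F ∈ E 𝔤 := by
  simp only [E, Submodule.mem_iInf, LinearMap.mem_ker]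
  intro z
  rw [act_hat, hF z]
  simp [hat]

end Hat

/-! ### Traces with coefficients -/

section CoeffTrace

open TensorProduct

variable {A C : Type*} [Ring A] [Algebra ℂ A] [Ring C] [Algebra ℂ C]
  {V : Type*} [AddCommGroup V] [Module ℂ V]

variable (A V) in
/-- The trace `A ⊗ End V → A` with coefficients in an algebra `A`. -/
noncomputable def coeffTrace : A ⊗[ℂ] Module.End ℂ V →ₗ[ℂ] A :=
  (TensorProduct.rid ℂ A).toLinearMap ∘ₗ (LinearMap.trace ℂ V).lTensor A

lemma coeffTrace_tmul (a : A) (f : Module.End ℂ V) :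
    coeffTrace A V (a ⊗ₜ f) = LinearMap.trace ℂ V f • a := by
  simp [coeffTrace]

lemma coeffTrace_rTensor (D : A →ₗ[ℂ] C) (T : A ⊗[ℂ] Module.End ℂ V) :
    coeffTrace C V (D.rTensor _ T) = D (coeffTrace A V T) := by
  induction T using TensorProduct.induction_on with
  | zero => simp
  | tmul a f => simp [coeffTrace_tmul]
  | add s t hs ht => simp [hs, ht]

lemma coeffTrace_coeff_mul (a : A) (T : A ⊗[ℂ] Module.End ℂ V) :
    coeffTrace A V (a ⊗ₜ 1 * T) = a * coeffTrace A V T := by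
  induction T using TensorProduct.induction_on with
  | zero => simp
  | tmul b f => simp [coeffTrace_tmul]
  | add s t hs ht => simp [mul_add, hs, ht]

lemma coeffTrace_mul_coeff (a : A) (T : A ⊗[ℂ] Module.End ℂ V) :
    coeffTrace A V (T * a ⊗ₜ 1) = coeffTrace A V T * a := by
  induction T using TensorProduct.induction_on with
  | zero => simp
  | tmul b f => simp [coeffTrace_tmul]
  | add s t hs ht => simp [add_mul, hs, ht]

lemma coeffTrace_mul_comm_end (g : Module.End ℂ V) (T : A ⊗[ℂ] Module.End ℂ V) :
    coeffTrace A V (T * 1 ⊗ₜ g) = coeffTrace A V (1 ⊗ₜ g * T) := by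
  induction T using TensorProduct.induction_on with
  | zero => simp
  | tmul b f => simp [coeffTrace_tmul, LinearMap.trace_mul_comm ℂ f g]
  | add s t hs ht => simp [add_mul, mul_add, hs, ht]

/-- The derivation of `A ⊗ End V` induced by a derivation of `A` satisfies the Leibniz rule. -/
lemma rTensor_derivation_mul {A : Type*} [CommRing A] [Algebra ℂ A] (D : Derivation ℂ A A)
    (s t : A ⊗[ℂ] Module.End ℂ V) :
    D.toLinearMap.rTensor _ (s * t)
      = D.toLinearMap.rTensor _ s * t + s * D.toLinearMap.rTensor _ t := by
  induction s using TensorProduct.induction_on with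
  | zero => simp
  | add s s' hs hs' => simp only [add_mul, map_add, hs, hs']; abel
  | tmul a f =>
    induction t using TensorProduct.induction_on with
    | zero => simp
    | add t t' ht ht' => simp only [mul_add, map_add, ht, ht']; abel
    | tmul b g =>
      simp only [Algebra.TensorProduct.tmul_mul_tmul, LinearMap.rTensor_tmul,
        Derivation.coeFn_coe, Derivation.leibniz, add_tmul, smul_eq_mul]
      rw [add_comm, mul_comm b]

/-- With commutative coefficients the trace is cyclic. -/
lemma coeffTrace_mul_comm {A : Type*} [CommRing A] [Algebra ℂ A]
    (s t : A ⊗[ℂ] Module.End ℂ V) :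
    coeffTrace (A) V (s * t) = coeffTrace (A) V (t * s) := by
  induction s using TensorProduct.induction_on with
  | zero => simp
  | add s s' hs hs' => simp [add_mul, mul_add, hs, hs']
  | tmul a f =>
    induction t using TensorProduct.induction_on with
    | zero => simp
    | add t t' ht ht' => simp [add_mul, mul_add, ht, ht']
    | tmul b g => simp [coeffTrace_tmul, LinearMap.trace_mul_comm ℂ f g, mul_comm a b]

end CoeffTrace

/-! ### The invariant polynomials `tr_V (z ^ k)` -/

section TracePower

open TensorProduct

variable {𝔤 : Type*} [LieRing 𝔤] [LieAlgebra ℂ 𝔤] [FiniteDimensional ℂ 𝔤]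
  (V : Type*) [AddCommGroup V] [Module ℂ V] [LieRingModule 𝔤 V] [LieModule ℂ 𝔤 V]

variable (𝔤) in
/-- The tautological element `∑ i, εᵢ ⊗ ρ(eᵢ)` of `S(𝔤*) ⊗ End V`, that is, the polynomial map
`z ↦ ρ(z)`. -/
noncomputable def genericEnd : S 𝔤 ⊗[ℂ] Module.End ℂ V :=
  ∑ i, SymmetricAlgebra.ι ℂ _ (ε 𝔤 i) ⊗ₜ[ℂ] LieModule.toEnd ℂ 𝔤 V (e 𝔤 i)

variable (𝔤) in
/-- The polynomial function `z ↦ tr_V (ρ(z) ^ k)`. -/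
noncomputable def tracePower (k : ℕ) : S 𝔤 := coeffTrace (S 𝔤) V (genericEnd 𝔤 V ^ k)

lemma rTensor_symAct_genericEnd (z : 𝔤) :
    (symAct z).toLinearMap.rTensor _ (genericEnd 𝔤 V)
      = genericEnd 𝔤 V * 1 ⊗ₜ LieModule.toEnd ℂ 𝔤 V z
        - 1 ⊗ₜ LieModule.toEnd ℂ 𝔤 V z * genericEnd 𝔤 V := by
  have h : ∑ i, SymmetricAlgebra.ι ℂ _ ⁅z, ε 𝔤 i⁆ ⊗ₜ[ℂ] LieModule.toEnd ℂ 𝔤 V (e 𝔤 i)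
      = - ∑ i, SymmetricAlgebra.ι ℂ _ (ε 𝔤 i) ⊗ₜ[ℂ] LieModule.toEnd ℂ 𝔤 V ⁅z, e 𝔤 i⁆ :=
    sum_coadjoint z (LinearMap.mk₂ ℂ
    (fun a ψ => SymmetricAlgebra.ι ℂ _ ψ ⊗ₜ[ℂ] LieModule.toEnd ℂ 𝔤 V a)
    (by intros; simp [tmul_add]) (by intros; simp)
    (by intros; simp [add_tmul]) (by intros; simp [smul_tmul']))
  simp only [genericEnd, map_sum, LinearMap.rTensor_tmul, Derivation.coeFn_coe, symAct_ι, h,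
    LieHom.map_lie,
    Finset.sum_mul, Finset.mul_sum, Algebra.TensorProduct.tmul_mul_tmul, one_mul, mul_one,
    Ring.lie_def, tmul_sub, Finset.sum_sub_distrib, neg_sub]

lemma tracePower_mem_invariants (k : ℕ) : tracePower 𝔤 V k ∈ invariants 𝔤 := by
  intro z
  have h : (symAct z).toLinearMap.rTensor _ (genericEnd 𝔤 V ^ k)
      = genericEnd 𝔤 V ^ k * 1 ⊗ₜ LieModule.toEnd ℂ 𝔤 V z
        - 1 ⊗ₜ LieModule.toEnd ℂ 𝔤 V z * genericEnd 𝔤 V ^ k := by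
    induction k with
    | zero => simp [Algebra.TensorProduct.one_def]
    | succ k ih =>
      rw [pow_succ, rTensor_derivation_mul, ih, rTensor_symAct_genericEnd]
      simp only [mul_sub, sub_mul, mul_assoc]
      abel
  have h2 := coeffTrace_rTensor (symAct z).toLinearMap (genericEnd 𝔤 V ^ k)
  rw [h, map_sub, coeffTrace_mul_comm_end, sub_self] at h2
  exact h2.symm

lemma rTensor_partialDer_genericEnd (i : Fin (finrank ℂ 𝔤)) :
    (partialDer (e 𝔤 i)).toLinearMap.rTensor _ (genericEnd 𝔤 V)
      = 1 ⊗ₜ LieModule.toEnd ℂ 𝔤 V (e 𝔤 i) := by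
  simp only [genericEnd, map_sum, LinearMap.rTensor_tmul, Derivation.coeFn_coe, partialDer_ι]
  rw [Finset.sum_eq_single i]
  · simp
  · intro j _ hj
    simp [hj.symm]
  · simp

/-- The power rule `d tr(Mᵏ⁺¹) = (k + 1) tr(Mᵏ dM)`. -/
lemma partialDer_tracePower (i : Fin (finrank ℂ 𝔤)) (k : ℕ) :
    partialDer (e 𝔤 i) (tracePower 𝔤 V (k + 1)) = ((k : ℂ) + 1) •
      coeffTrace (S 𝔤) V (genericEnd 𝔤 V ^ k * 1 ⊗ₜ LieModule.toEnd ℂ 𝔤 V (e 𝔤 i)) := by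
  -- The factor `T`, commuting with `M`, collects the powers of `M` split off in the induction.
  have h : ∀ (k : ℕ) (T : S 𝔤 ⊗[ℂ] Module.End ℂ V), Commute T (genericEnd 𝔤 V) →
      coeffTrace (S 𝔤) V ((partialDer (e 𝔤 i)).toLinearMap.rTensor _ (genericEnd 𝔤 V ^ k) * T)
      = (k : ℂ) • coeffTrace (S 𝔤) V (genericEnd 𝔤 V ^ (k - 1) * T *
        1 ⊗ₜ LieModule.toEnd ℂ 𝔤 V (e 𝔤 i)) := by
    intro k
    induction k with
    | zero => intro T _; simp [Algebra.TensorProduct.one_def]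
    | succ k ih =>
      intro T hT
      have hTk : T * genericEnd 𝔤 V ^ k = genericEnd 𝔤 V ^ k * T :=
        (Commute.pow_right (M := S 𝔤 ⊗[ℂ] Module.End ℂ V) hT k).eq
      rw [pow_succ, rTensor_derivation_mul, rTensor_partialDer_genericEnd, add_mul, map_add,
        mul_assoc, ih _ ((Commute.refl _).mul_left hT), Nat.add_sub_cancel, Nat.cast_add,
        Nat.cast_one, add_smul, one_smul]
      congr 1
      · rcases k with _ | k
        · simp
        · rw [Nat.add_sub_cancel, ← mul_assoc, pow_succ]
      · rw [mul_assoc, coeffTrace_mul_comm, mul_assoc, coeffTrace_mul_comm, mul_assoc,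
          ← mul_assoc T, hTk]
  have h1 := h (k + 1) 1 (Commute.one_left _)
  rw [mul_one, mul_one, Nat.add_sub_cancel, coeffTrace_rTensor] at h1
  push_cast at h1
  exact h1

end TracePower

/-! ### Words in `X` and `Y` -/

section WordTrace

open TensorProduct

variable {𝔤 : Type*} [LieRing 𝔤] [LieAlgebra ℂ 𝔤]
  (V : Type*) [AddCommGroup V] [Module ℂ V]

lemma toEnd_lie [LieRingModule 𝔤 V] [LieModule ℂ 𝔤 V] (a b : 𝔤) :
    LieModule.toEnd ℂ 𝔤 V ⁅a, b⁆ = LieModule.toEnd ℂ 𝔤 V a * LieModule.toEnd ℂ 𝔤 V b -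
      LieModule.toEnd ℂ 𝔤 V b * LieModule.toEnd ℂ 𝔤 V a := by
  ext v
  simp

variable [FiniteDimensional ℂ 𝔤]

variable (𝔤) in
/-- Evaluation at `{X, Y}` of `End V`-valued polynomials. -/
noncomputable def evalEnd : S 𝔤 ⊗[ℂ] Module.End ℂ V →ₐ[ℂ] BB 𝔤 ⊗[ℂ] Module.End ℂ V :=
  Algebra.TensorProduct.map evalXY (AlgHom.id ℂ _)

lemma coeffTrace_evalEnd (T : S 𝔤 ⊗[ℂ] Module.End ℂ V) :
    coeffTrace (BB 𝔤) V (evalEnd 𝔤 V T) = evalXY (coeffTrace (S 𝔤) V T) :=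
  coeffTrace_rTensor (evalXY (𝔤 := 𝔤)).toLinearMap T

/-- Exchange of the two letters. -/
def Letter.swap : Letter → Letter
  | .X => .Y
  | .Y => .X

lemma coords_anticomm (l l' : Letter) (φ ψ : Dual ℂ 𝔤) :
    l.coords 𝔤 φ * l'.coords 𝔤 ψ = -(l'.coords 𝔤 ψ * l.coords 𝔤 φ) := by
  cases l <;> cases l' <;> exact gen_anticomm _ _

lemma superBracket_coords_self (l : Letter) (φ : Dual ℂ 𝔤) :
    superBracket (l.coords 𝔤) (l.coords 𝔤) φ = 0 := by
  cases l
  exacts [superBracket_x_x φ, superBracket_y_y φ]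

variable [LieRingModule 𝔤 V] [LieModule ℂ 𝔤 V]

lemma coords_tmul_one_mul_letterV (l l' : Letter) (φ : Dual ℂ 𝔤) :
    (l.coords 𝔤 φ ⊗ₜ 1) * letterV V l'
      = (-1 : ℂ) • (letterV (𝔤 := 𝔤) V l' * (l.coords 𝔤 φ ⊗ₜ 1)) := by
  simp only [letterV, Finset.mul_sum, Finset.sum_mul, Algebra.TensorProduct.tmul_mul_tmul,
    one_mul, mul_one, Finset.smul_sum]
  exact Finset.sum_congr rfl fun i _ => by rw [coords_anticomm, smul_tmul', neg_one_smul]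

lemma coords_tmul_one_commute (l l' l'' : Letter) (φ : Dual ℂ 𝔤) :
    Commute (l.coords 𝔤 φ ⊗ₜ[ℂ] (1 : Module.End ℂ V)) (letterV V l' * letterV V l'') := by
  change _ * _ = _ * _
  rw [← mul_assoc, coords_tmul_one_mul_letterV, smul_mul_assoc, mul_assoc,
    coords_tmul_one_mul_letterV, mul_smul_comm, smul_smul, neg_one_mul, neg_neg, one_smul,
    mul_assoc]

/-- In `(B ⊗ B) ⊗ End V`, the supercommutator of two letters is the image of `{·, ·}`. -/
lemma letterV_anticommutator (l l' : Letter) :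
    letterV (𝔤 := 𝔤) V l * letterV V l' + letterV V l' * letterV V l
      = ∑ k, superBracket (l.coords 𝔤) (l'.coords 𝔤) (ε 𝔤 k) ⊗ₜ
        LieModule.toEnd ℂ 𝔤 V (e 𝔤 k) := by
  have hlie : ∀ i j, LieModule.toEnd ℂ 𝔤 V (e 𝔤 i) * LieModule.toEnd ℂ 𝔤 V (e 𝔤 j)
      - LieModule.toEnd ℂ 𝔤 V (e 𝔤 j) * LieModule.toEnd ℂ 𝔤 V (e 𝔤 i)
      = ∑ k, ε 𝔤 k ⁅e 𝔤 i, e 𝔤 j⁆ • LieModule.toEnd ℂ 𝔤 V (e 𝔤 k) := fun i j => by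
    rw [← toEnd_lie]
    conv_lhs => rw [← (e 𝔤).sum_repr ⁅e 𝔤 i, e 𝔤 j⁆]
    simp [-Basis.sum_repr]
  have h1 : letterV (𝔤 := 𝔤) V l' * letterV V l
      = - ∑ i, ∑ j, (l.coords 𝔤 (ε 𝔤 i) * l'.coords 𝔤 (ε 𝔤 j)) ⊗ₜ
        (LieModule.toEnd ℂ 𝔤 V (e 𝔤 j) * LieModule.toEnd ℂ 𝔤 V (e 𝔤 i)) := by
    simp only [letterV, Finset.mul_sum, Finset.sum_mul, Algebra.TensorProduct.tmul_mul_tmul,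
      ← Finset.sum_neg_distrib, ← neg_tmul]
    refine Finset.sum_congr rfl fun i _ => Finset.sum_congr rfl fun j _ => ?_
    rw [coords_anticomm]
  have h2 : letterV (𝔤 := 𝔤) V l * letterV V l'
      = ∑ i, ∑ j, (l.coords 𝔤 (ε 𝔤 i) * l'.coords 𝔤 (ε 𝔤 j)) ⊗ₜ
        (LieModule.toEnd ℂ 𝔤 V (e 𝔤 i) * LieModule.toEnd ℂ 𝔤 V (e 𝔤 j)) := by
    simp only [letterV, Finset.mul_sum, Finset.sum_mul, Algebra.TensorProduct.tmul_mul_tmul]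
    exact Finset.sum_comm
  rw [h1, h2, ← sub_eq_add_neg]
  simp only [← Finset.sum_sub_distrib, ← tmul_sub, hlie, superBracket, LinearMap.coe_mk,
    AddHom.coe_mk, tmul_sum, sum_tmul, tmul_smul, smul_tmul']
  rw [Finset.sum_congr rfl fun i _ => Finset.sum_comm, Finset.sum_comm]

lemma letterV_mul_self (l : Letter) : letterV (𝔤 := 𝔤) V l * letterV V l = 0 := by
  have h := letterV_anticommutator (𝔤 := 𝔤) V l l
  simp only [superBracket_coords_self, zero_tmul, Finset.sum_const_zero, ← two_smul ℂ] at h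
  exact (smul_eq_zero.mp h).resolve_left two_ne_zero

lemma evalEnd_genericEnd :
    evalEnd 𝔤 V (genericEnd 𝔤 V) = letterV V .X * letterV V .Y + letterV V .Y * letterV V .X := by
  rw [letterV_anticommutator]
  simp [evalEnd, genericEnd, evalXY_ι, Letter.coords]

variable (𝔤) in
/-- The derivative at `{X, Y}`, in the direction `X`, of an `End V`-valued polynomial. -/
noncomputable def diffEnd (T : S 𝔤 ⊗[ℂ] Module.End ℂ V) : BB 𝔤 ⊗[ℂ] Module.End ℂ V :=
  ∑ i, evalEnd 𝔤 V ((partialDer (e 𝔤 i)).toLinearMap.rTensor _ T) * (x 𝔤 (ε 𝔤 i) ⊗ₜ 1)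

/-- `X` and `{X, Y}` commute, so the power rule holds for the derivative in the direction `X`. -/
lemma diffEnd_genericEnd_pow (k : ℕ) :
    diffEnd 𝔤 V (genericEnd 𝔤 V ^ (k + 1))
      = ((k : ℂ) + 1) • (evalEnd 𝔤 V (genericEnd 𝔤 V) ^ k * letterV V .X) := by
  have hmul : ∀ s t, evalEnd 𝔤 V (s * t) = evalEnd 𝔤 V s * evalEnd 𝔤 V t := map_mul _
  have hpow : ∀ k, evalEnd 𝔤 V (genericEnd 𝔤 V ^ k) = evalEnd 𝔤 V (genericEnd 𝔤 V) ^ k := by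
    intro k
    induction k with
    | zero => simp [evalEnd, Algebra.TensorProduct.one_def]
    | succ k ih => rw [pow_succ, pow_succ, hmul, ih]
  have hxZ : ∀ i, (x 𝔤 (ε 𝔤 i) ⊗ₜ 1) * evalEnd 𝔤 V (genericEnd 𝔤 V)
      = evalEnd 𝔤 V (genericEnd 𝔤 V) * (x 𝔤 (ε 𝔤 i) ⊗ₜ 1) := fun i => by
    rw [evalEnd_genericEnd, mul_add, add_mul]
    exact congrArg₂ _ (coords_tmul_one_commute V .X .X .Y _).eq
      (coords_tmul_one_commute V .X .Y .X _).eq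
  have hXZ : letterV V .X * evalEnd 𝔤 V (genericEnd 𝔤 V)
      = evalEnd 𝔤 V (genericEnd 𝔤 V) * letterV V .X := by
    rw [evalEnd_genericEnd, mul_add, add_mul, ← mul_assoc, letterV_mul_self, zero_mul, zero_add,
      mul_assoc (letterV V .Y), letterV_mul_self, mul_zero, add_zero, mul_assoc]
  have hM : ∀ k, ∑ i, evalEnd 𝔤 V (genericEnd 𝔤 V ^ k *
      1 ⊗ₜ LieModule.toEnd ℂ 𝔤 V (e 𝔤 i)) * (x 𝔤 (ε 𝔤 i) ⊗ₜ 1)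
      = evalEnd 𝔤 V (genericEnd 𝔤 V) ^ k * letterV V .X := fun k => by
    rw [letterV, Finset.mul_sum]
    refine Finset.sum_congr rfl fun i _ => ?_
    rw [hmul, hpow, mul_assoc]
    simp [evalEnd, Letter.coords]
  induction k with
  | zero =>
    rw [← hM 0]
    simp [diffEnd, rTensor_partialDer_genericEnd]
  | succ k ih =>
    have h : diffEnd 𝔤 V (genericEnd 𝔤 V ^ (k + 1 + 1))
        = diffEnd 𝔤 V (genericEnd 𝔤 V ^ (k + 1)) * evalEnd 𝔤 V (genericEnd 𝔤 V)
          + evalEnd 𝔤 V (genericEnd 𝔤 V) ^ (k + 1) * letterV V .X := by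
      rw [← hM]
      simp only [diffEnd, Finset.sum_mul, ← Finset.sum_add_distrib]
      refine Finset.sum_congr rfl fun i _ => ?_
      rw [pow_succ _ (k + 1), rTensor_derivation_mul, rTensor_partialDer_genericEnd, map_add,
        add_mul, hmul, mul_assoc, ← hxZ, ← mul_assoc]
    rw [h, ih, smul_mul_assoc, mul_assoc, hXZ, ← mul_assoc, ← pow_succ, Nat.cast_add,
      Nat.cast_one, add_smul ((k : ℂ) + 1), one_smul]

/-- `hat` of the polynomial `z ↦ tr_V (ρ(z) ^ (k + 2))` is a multiple of `Tr_V ((XY) ^ (k + 1))`. -/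
lemma hat_tracePower (k : ℕ) :
    hat (tracePower 𝔤 V (k + 2)) = (((k : ℂ) + 2) * ((k : ℂ) + 1)) •
      coeffTrace (BB 𝔤) V ((letterV V .X * letterV V .Y) ^ (k + 1)) := by
  have hZ : evalEnd 𝔤 V (genericEnd 𝔤 V) ^ k * (letterV V .X * letterV V .Y)
      = (letterV V .X * letterV V .Y) ^ (k + 1) := by
    induction k with
    | zero => simp
    | succ k ih =>
      rw [pow_succ', mul_assoc, ih, evalEnd_genericEnd, add_mul, ← pow_succ', pow_succ' _ k,
        mul_assoc (letterV V .Y), ← mul_assoc (letterV V .X) (_ * _), ← mul_assoc (letterV V .X),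
        letterV_mul_self, zero_mul, zero_mul, mul_zero, add_zero]
  have hi : ∀ j, ∑ i, evalXY (partialDer (e 𝔤 i) (coeffTrace (S 𝔤) V (genericEnd 𝔤 V ^ (k + 1) *
      1 ⊗ₜ LieModule.toEnd ℂ 𝔤 V (e 𝔤 j)))) * x 𝔤 (ε 𝔤 i)
      = coeffTrace (BB 𝔤) V (diffEnd 𝔤 V (genericEnd 𝔤 V ^ (k + 1)) *
        1 ⊗ₜ LieModule.toEnd ℂ 𝔤 V (e 𝔤 j)) := fun j => by
    rw [diffEnd, Finset.sum_mul, map_sum]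
    refine Finset.sum_congr rfl fun i _ => ?_
    have h0 : (partialDer (e 𝔤 i)).toLinearMap.rTensor _
        ((1 : S 𝔤) ⊗ₜ[ℂ] LieModule.toEnd ℂ 𝔤 V (e 𝔤 j)) = 0 := by simp
    have hc : (x 𝔤 (ε 𝔤 i) ⊗ₜ[ℂ] (1 : Module.End ℂ V)) * 1 ⊗ₜ LieModule.toEnd ℂ 𝔤 V (e 𝔤 j)
        = evalEnd 𝔤 V (1 ⊗ₜ LieModule.toEnd ℂ 𝔤 V (e 𝔤 j)) * (x 𝔤 (ε 𝔤 i) ⊗ₜ[ℂ] 1) := by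
      simp [evalEnd]
    rw [mul_assoc, hc, ← mul_assoc, coeffTrace_mul_coeff, ← map_mul, coeffTrace_evalEnd]
    congr 2
    have := coeffTrace_rTensor (partialDer (e 𝔤 i)).toLinearMap
      (genericEnd 𝔤 V ^ (k + 1) * 1 ⊗ₜ LieModule.toEnd ℂ 𝔤 V (e 𝔤 j))
    rw [rTensor_derivation_mul, h0, mul_zero, add_zero] at this
    exact this.symm
  have hcast : (((k + 1 : ℕ) : ℂ) + 1) = (k : ℂ) + 2 := by push_cast; ring
  rw [hat, Finset.sum_comm]
  simp only [partialDer_tracePower, hcast, Derivation.map_smul, map_smul, smul_mul_assoc,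
    ← mul_assoc, ← Finset.smul_sum, ← Finset.sum_mul, hi, diffEnd_genericEnd_pow]
  rw [mul_smul]
  congr 2
  rw [← hZ, ← mul_assoc]
  conv_rhs => rw [letterV.eq_1 V .Y, Finset.mul_sum, map_sum]
  refine Finset.sum_congr rfl fun j _ => ?_
  rw [← coeffTrace_mul_coeff, mul_assoc]
  simp [Letter.coords]

/-- Cyclicity of the trace, with the sign rule: if moving the odd coordinates of a letter past `T`
costs the sign `s`, then so does moving the letter cyclically. -/
lemma coeffTrace_letterV_mul (l : Letter) (s : ℂ) (T : BB 𝔤 ⊗[ℂ] Module.End ℂ V)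
    (hT : ∀ φ, (l.coords 𝔤 φ ⊗ₜ 1) * T = s • (T * (l.coords 𝔤 φ ⊗ₜ 1))) :
    coeffTrace (BB 𝔤) V (letterV V l * T) = s • coeffTrace (BB 𝔤) V (T * letterV V l) := by
  rw [letterV, Finset.sum_mul, Finset.mul_sum, map_sum, map_sum, Finset.smul_sum]
  refine Finset.sum_congr rfl fun i _ => ?_
  set a := l.coords 𝔤 (ε 𝔤 i) with ha
  set f := LieModule.toEnd ℂ 𝔤 V (e 𝔤 i)
  have h1 : a ⊗ₜ[ℂ] f = (a ⊗ₜ 1) * (1 ⊗ₜ f) := by simp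
  have h2 : (a ⊗ₜ[ℂ] (1 : Module.End ℂ V)) * (1 ⊗ₜ f) = (1 ⊗ₜ f) * (a ⊗ₜ 1) := by simp
  rw [h1, mul_assoc, coeffTrace_coeff_mul, ← coeffTrace_mul_comm_end, ← coeffTrace_coeff_mul,
    ← mul_assoc, hT, smul_mul_assoc, map_smul, mul_assoc]

/-- A single letter has trace zero, since `𝔤` is perfect. -/
lemma coeffTrace_letterV [LieAlgebra.IsSimple ℂ 𝔤] (l : Letter) :
    coeffTrace (BB 𝔤) V (letterV V l) = 0 := by
  let τ : 𝔤 →ₗ[ℂ] ℂ :=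
    { toFun := fun a => LinearMap.trace ℂ V (LieModule.toEnd ℂ 𝔤 V a)
      map_add' := by simp
      map_smul' := by simp }
  have hτ : τ = 0 := eq_zero_of_forall_lie τ fun a b => by
    change LinearMap.trace ℂ V (LieModule.toEnd ℂ 𝔤 V ⁅a, b⁆) = 0
    rw [toEnd_lie, map_sub, LinearMap.trace_mul_comm, sub_self]
  have h : ∀ a, LinearMap.trace ℂ V (LieModule.toEnd ℂ 𝔤 V a) = 0 := DFunLike.congr_fun hτ
  simp [letterV, coeffTrace_tmul, h]

lemma letterV_mul_pow (l : Letter) (m : ℕ) :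
    letterV (𝔤 := 𝔤) V l * (letterV V l.swap * letterV V l) ^ m
      = (letterV V l * letterV V l.swap) ^ m * letterV V l := by
  induction m with
  | zero => simp
  | succ m ih => rw [pow_succ, ← mul_assoc, ih, pow_succ]; simp only [mul_assoc]

lemma Letter.swap_swap (l : Letter) : l.swap.swap = l := by cases l <;> rfl

/-- Since the square of a letter is zero, a word is zero or alternating. -/
lemma wordV_cons (l : Letter) (u : List Letter) :
    wordV (𝔤 := 𝔤) V (l :: u) = 0 ∨
      (∃ m, wordV (𝔤 := 𝔤) V (l :: u) = (letterV V l * letterV V l.swap) ^ m * letterV V l) ∨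
      ∃ m, wordV (𝔤 := 𝔤) V (l :: u) = (letterV V l * letterV V l.swap) ^ (m + 1) := by
  have hcons : ∀ (l : Letter) (u : List Letter),
      wordV (𝔤 := 𝔤) V (l :: u) = letterV V l * wordV V u := fun l u => by simp [wordV]
  induction u generalizing l with
  | nil => exact Or.inr (Or.inl ⟨0, by simp [wordV]⟩)
  | cons l' u ih =>
    by_cases hl : l' = l
    · subst hl
      exact Or.inl (by rw [hcons, hcons, ← mul_assoc, letterV_mul_self, zero_mul])
    · have hl' : l' = l.swap := by cases l <;> cases l' <;> simp_all [Letter.swap]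
      subst hl'
      rw [hcons l]
      rcases ih l.swap with h | ⟨m, h⟩ | ⟨m, h⟩
      · exact Or.inl (by rw [h, mul_zero])
      · refine Or.inr (Or.inr ⟨m, ?_⟩)
        rw [h, Letter.swap_swap, ← mul_assoc, letterV_mul_pow, pow_succ, mul_assoc]
      · refine Or.inr (Or.inl ⟨m + 1, ?_⟩)
        rw [h, Letter.swap_swap, letterV_mul_pow]

/-- A letter moved cyclically around a longer word of odd length meets itself. -/
lemma coeffTrace_odd_word [LieAlgebra.IsSimple ℂ 𝔤] (l : Letter) (m : ℕ) :
    coeffTrace (BB 𝔤) V ((letterV V l * letterV V l.swap) ^ m * letterV V l) = 0 := by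
  rcases m with _ | m
  · rw [pow_zero, one_mul, coeffTrace_letterV]
  · rw [← letterV_mul_pow, coeffTrace_letterV_mul V l 1, pow_succ, mul_assoc,
      mul_assoc (letterV V l.swap), letterV_mul_self, mul_zero, mul_zero, map_zero, smul_zero]
    intro φ
    rw [one_smul]
    exact ((coords_tmul_one_commute V l l.swap l φ).pow_right (m + 1)).eq

lemma coeffTrace_YX_pow (m : ℕ) :
    coeffTrace (BB 𝔤) V ((letterV V .Y * letterV V .X) ^ (m + 1))
      = -coeffTrace (BB 𝔤) V ((letterV V .X * letterV V .Y) ^ (m + 1)) := by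
  rw [pow_succ', mul_assoc, coeffTrace_letterV_mul V .Y (-1), neg_one_smul]
  · rw [pow_succ, ← mul_assoc]
    exact congrArg (fun T => -coeffTrace (BB 𝔤) V (T * letterV V .Y)) (letterV_mul_pow V .X m)
  · intro φ
    rw [← mul_assoc, coords_tmul_one_mul_letterV, smul_mul_assoc, mul_assoc, mul_assoc,
      ((coords_tmul_one_commute V .Y .Y .X φ).pow_right m).eq]

lemma exists_wordTrace_eq_smul_hat [LieAlgebra.IsSimple ℂ 𝔤] {w : List Letter} (hw : w ≠ []) :
    ∃ (c : ℂ) (k : ℕ), wordTrace 𝔤 V w = c • hat (tracePower 𝔤 V k) := by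
  have hXY : ∀ m : ℕ, coeffTrace (BB 𝔤) V ((letterV V .X * letterV V .Y) ^ (m + 1))
      = (((m : ℂ) + 2) * ((m : ℂ) + 1))⁻¹ • hat (tracePower 𝔤 V (m + 2)) := fun m => by
    rw [hat_tracePower, inv_smul_smul₀]
    exact mul_ne_zero (by exact_mod_cast (by omega : m + 2 ≠ 0)) (Nat.cast_add_one_ne_zero m)
  obtain ⟨l, u, rfl⟩ := List.exists_cons_of_ne_nil hw
  change ∃ (c : ℂ) (k : ℕ), coeffTrace (BB 𝔤) V (wordV V (l :: u)) = c • _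
  rcases wordV_cons (𝔤 := 𝔤) V l u with h | ⟨m, h⟩ | ⟨m, h⟩
  · exact ⟨0, 0, by rw [h, map_zero, zero_smul]⟩
  · exact ⟨0, 0, by rw [h, coeffTrace_odd_word, zero_smul]⟩
  · rw [h]
    cases l with
    | X => exact ⟨_, _, hXY m⟩
    | Y => exact ⟨_, _, (coeffTrace_YX_pow V m).trans (by rw [hXY, ← neg_smul])⟩

end WordTrace

end CDSW

theorem mainTheorem8
    {𝔤 : Type*} [LieRing 𝔤] [LieAlgebra ℂ 𝔤] [FiniteDimensional ℂ 𝔤] [LieAlgebra.IsSimple ℂ 𝔤]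
    {V : Type*} [AddCommGroup V] [Module ℂ V] [FiniteDimensional ℂ V]
    [LieRingModule 𝔤 V] [LieModule ℂ 𝔤 V]
    {I : Type*} (p : I → CDSW.S 𝔤) (d : I → ℕ)
    (hp : ∀ i, CDSW.IsHomogeneous (p i) (d i))
    (hgen : Algebra.adjoin ℂ (Set.range p) = CDSW.invariants 𝔤)
    (w : List CDSW.Letter) (hw : w ≠ []) :
    (∀ i, CDSW.hat (p i) ∈ CDSW.E 𝔤) ∧
      CDSW.wordTrace 𝔤 V w ∈ CDSW.E 𝔤 ∧
      CDSW.wordTrace 𝔤 V w ∈ Submodule.span ℂ (Set.range fun i => CDSW.hat (p i)) := by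
  have hinv : ∀ i, p i ∈ CDSW.invariants 𝔤 := fun i =>
    hgen ▸ Algebra.subset_adjoin (Set.mem_range_self i)
  obtain ⟨c, k, h⟩ := CDSW.exists_wordTrace_eq_smul_hat (𝔤 := 𝔤) V hw
  have hF := CDSW.tracePower_mem_invariants (𝔤 := 𝔤) V k
  rw [h]
  exact ⟨fun i => CDSW.hat_mem_E (hinv i), Submodule.smul_mem _ c (CDSW.hat_mem_E hF),
    Submodule.smul_mem _ c (CDSW.hat_mem_span_of_invariant p d hp hgen hF)⟩
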